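/- Let $q \in (-1,1)\setminus\{0\}$ and let $\theta \in (0,1)$ be irrational. Let $\mathrm{Pol}(SU_q(2))$ be the universal unital complex $*$-algebra generated by $\alpha,\gamma$ subject to $$\gamma^*\gamma=\gamma\gamma^*,\quad q\,\gamma^*\alpha=\alpha\gamma^*,\quad q\,\gamma\alpha=\alpha\gamma,\quad \alpha^*\alpha+\gamma^*\gamma=1,\quad \alpha\alpha^*+q^2\gamma\gamma^*=1,$$ and let $\rho_\theta$ be its $*$-automorphism with $\alpha\mapsto\alpha$, $\gamma\mapsto e^{2\pi i\theta}\gamma$. Let $\mathrm{Pol}(\mathbb{G}_q^\theta)=\mathrm{Pol}(SU_q(2))\rtimes_{\rho_\theta}\mathbb{Z}$ be the algebraic crossed product, that is, the universal unital $*$-algebra generated by $\mathrm{Pol}(SU_q(2))$ and a unitary $u_\theta$ subject to $$u_\theta^*\gamma u_\theta=e^{2\pi i\theta}\gamma,\qquad u_\theta^*\alpha u_\theta=\alpha .$$ A pre-C*-norm on a unital complex $*$-algebra is a norm for which the completion of the algebra is a C*-algebra. **Theorem 4.6.** The $*$-algebra $\mathrm{Pol}(\mathbb{G}_q^\theta)$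 is C*-unique: it has exactly one pre-C*-norm. -/

import Mathlib

universe u

noncomputable section

namespace QuantumAlg

/-- The free unital complex `*`-algebra on a set `X` of generators: noncommutative polynomials in
the letters `x` (written `Sum.inl x`) and their formal adjoints (written `Sum.inr x`). -/
def FreeStarAlgebra (X : Type u) : Type u := FreeAlgebra ℂ (X ⊕ X)

namespace FreeStarAlgebra

variable {X : Type u}

instance : Ring (FreeStarAlgebra X) := inferInstanceAs (Ring (FreeAlgebra ℂ (X ⊕ X)))

instance : Algebra ℂ (FreeStarAlgebra X) := inferInstanceAs (Algebra ℂ (FreeAlgebra ℂ (X ⊕ X)))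

/-- A letter of the free `*`-algebra: a generator or a formal adjoint of a generator. -/
def letter (y : X ⊕ X) : FreeStarAlgebra X := FreeAlgebra.ι ℂ y

/-- A generator of the free `*`-algebra. -/
def of (x : X) : FreeStarAlgebra X := letter (Sum.inl x)

/-- The formal adjoint of a generator of the free `*`-algebra. -/
def ofStar (x : X) : FreeStarAlgebra X := letter (Sum.inr x)

/-- The ring `FreeStarAlgebra X` with reversed multiplication and with scalars acting through
complex conjugation. -/
def ConjOp (X : Type u) : Type u := (FreeStarAlgebra X)ᵐᵒᵖ

instance : Ring (ConjOp X) := inferInstanceAs (Ring (FreeStarAlgebra X)ᵐᵒᵖ)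

instance : Algebra ℂ (ConjOp X) :=
  RingHom.toAlgebra' ((algebraMap ℂ (FreeStarAlgebra X)ᵐᵒᵖ).comp (starRingEnd ℂ))
    (fun c x => Algebra.commutes (A := (FreeStarAlgebra X)ᵐᵒᵖ) (starRingEnd ℂ c) x)

/-- The conjugate-linear antimultiplicative map exchanging every generator with its formal
adjoint, as an algebra homomorphism into `ConjOp X`. -/
def starHom : FreeStarAlgebra X →ₐ[ℂ] ConjOp X :=
  FreeAlgebra.lift ℂ (A := ConjOp X) (fun y => MulOpposite.op (letter y.swap))

instance : Star (FreeStarAlgebra X) := ⟨fun a => MulOpposite.unop (starHom a)⟩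

theorem star_def (a : FreeStarAlgebra X) : star a = MulOpposite.unop (starHom a) := rfl

theorem star_letter (y : X ⊕ X) : star (letter y) = letter y.swap :=
  congrArg MulOpposite.unop (FreeAlgebra.lift_ι_apply (R := ℂ) (A := ConjOp X) _ y)

theorem star_of (x : X) : star (of x) = ofStar x := star_letter (Sum.inl x)

theorem star_ofStar (x : X) : star (ofStar x) = of x := star_letter (Sum.inr x)

theorem star_mul_aux (a b : FreeStarAlgebra X) : star (a * b) = star b * star a :=
  congrArg MulOpposite.unop (map_mul starHom a b)

theorem star_add_aux (a b : FreeStarAlgebra X) : star (a + b) = star a + star b :=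
  congrArg MulOpposite.unop (map_add starHom a b)

theorem star_algebraMap (c : ℂ) :
    star (algebraMap ℂ (FreeStarAlgebra X) c) = algebraMap ℂ (FreeStarAlgebra X) (star c) :=
  congrArg MulOpposite.unop (starHom.commutes c)

instance : StarRing (FreeStarAlgebra X) where
  star_involutive a := by
    induction a using FreeAlgebra.induction with
    | grade0 c =>
      exact (congrArg star (star_algebraMap c)).trans
        ((star_algebraMap _).trans (by rw [star_star]; rfl))
    | grade1 y =>
      exact (congrArg star (star_letter y)).trans ((star_letter _).trans (by rw [Sum.swap_swap]; rfl))
    | mul a b ha hb =>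
      exact (congrArg star (star_mul_aux a b)).trans
        ((star_mul_aux _ _).trans (congrArg₂ (fun x y : FreeStarAlgebra X => x * y) ha hb))
    | add a b ha hb =>
      exact (congrArg star (star_add_aux a b)).trans
        ((star_add_aux _ _).trans (congrArg₂ (fun x y : FreeStarAlgebra X => x + y) ha hb))
  star_mul := star_mul_aux
  star_add := star_add_aux

instance : StarModule ℂ (FreeStarAlgebra X) where
  star_smul c a := by
    rw [Algebra.smul_def, star_mul, star_algebraMap, Algebra.smul_def, Algebra.commutes]

end FreeStarAlgebra

/-- The letters `α, γ` (generators of `Pol(SU_q(2))`) and the unitary `u` implementing the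
action of `ℤ`. -/
inductive Gen : Type
  | α
  | γ
  | u

open FreeStarAlgebra in
/-- The defining relations of the algebraic crossed product `Pol(SU_q(2)) ⋊ ℤ` with respect to
the automorphism `α ↦ α`, `γ ↦ exp(2πiθ) γ`: the relations of `Pol(SU_q(2))` between `α` and `γ`,
unitarity of `u`, and the two covariance relations. The last constructor closes the list under
adjoints, so that the quotient by these relations is a `*`-algebra. -/
inductive PolRel (q θ : ℝ) : FreeStarAlgebra Gen → FreeStarAlgebra Gen → Prop
  | γ_normal : PolRel q θ (star (of .γ) * of .γ) (of .γ * star (of .γ))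
  | γstar_α : PolRel q θ ((q : ℂ) • (star (of .γ) * of .α)) (of .α * star (of .γ))
  | γ_α : PolRel q θ ((q : ℂ) • (of .γ * of .α)) (of .α * of .γ)
  | sphere : PolRel q θ (star (of .α) * of .α + star (of .γ) * of .γ) 1
  | sphere' : PolRel q θ (of .α * star (of .α) + ((q : ℂ) ^ 2) • (of .γ * star (of .γ))) 1
  | u_isometry : PolRel q θ (star (of .u) * of .u) 1
  | u_coisometry : PolRel q θ (of .u * star (of .u)) 1
  | u_γ : PolRel q θ (star (of .u) * of .γ * of .u)
      (Complex.exp (2 * Real.pi * Complex.I * θ) • of .γ)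
  | u_α : PolRel q θ (star (of .u) * of .α * of .u) (of .α)
  | adjoint {a b : FreeStarAlgebra Gen} : PolRel q θ a b → PolRel q θ (star a) (star b)

/-- The `*`-algebra `Pol(𝔾_q^θ) = Pol(SU_q(2)) ⋊ ℤ`: the universal unital complex `*`-algebra
generated by `α`, `γ` and `u` subject to the relations `PolRel q θ`. -/
def Pol (q θ : ℝ) : Type := RingQuot (PolRel q θ)

namespace Pol

variable {q θ : ℝ}

instance : Ring (Pol q θ) := inferInstanceAs (Ring (RingQuot (PolRel q θ)))

instance : Algebra ℂ (Pol q θ) := inferInstanceAs (Algebra ℂ (RingQuot (PolRel q θ)))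

instance : StarRing (Pol q θ) := RingQuot.starRing (PolRel q θ) (fun _ _ h => PolRel.adjoint h)

/-- The quotient map from the free `*`-algebra. -/
def mk : FreeStarAlgebra Gen →ₐ[ℂ] Pol q θ := RingQuot.mkAlgHom ℂ (PolRel q θ)

theorem mk_surjective : Function.Surjective (mk (q := q) (θ := θ)) :=
  RingQuot.mkAlgHom_surjective ℂ (PolRel q θ)

theorem mk_star (a : FreeStarAlgebra Gen) : mk (q := q) (θ := θ) (star a) = star (mk a) := by
  simp only [mk, RingQuot.mkAlgHom_def, RingQuot.mkRingHom_def]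
  rfl

instance : StarModule ℂ (Pol q θ) where
  star_smul c a := by
    obtain ⟨x, rfl⟩ := mk_surjective a
    rw [← map_smul, ← mk_star, star_smul, map_smul, mk_star]

end Pol

/-- A pre-C*-norm on a unital complex `*`-algebra `A` is a norm for which the completion of `A` is
a C*-algebra. That is: there are a C*-algebra `B` (complete by definition) and an injective unital
`*`-homomorphism from `A` onto a dense subalgebra of `B` that is isometric for the given norm. -/
def IsPreCStarNorm {A : Type u} [Ring A] [Algebra ℂ A] [StarRing A] (p : A → ℝ) : Prop :=
  ∃ (B : Type u) (_ : CStarAlgebra B) (φ : A →⋆ₐ[ℂ] B),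
    Function.Injective φ ∧ DenseRange φ ∧ ∀ a : A, p a = ‖φ a‖

/-- A unital complex `*`-algebra is C*-unique if it has exactly one pre-C*-norm. -/
def IsCStarUnique (A : Type u) [Ring A] [Algebra ℂ A] [StarRing A] : Prop :=
  ∃! p : A → ℝ, IsPreCStarNorm p

end QuantumAlg

end

noncomputable section

namespace QuantumAlg

open Polynomial Filter Topology

/-! The key point is rigidity: in a C*-algebra, any triple obeying the relations with `g ≠ 0` forces
the spectrum of h = g*g to contain every q^(2k), and the only other possible spectral point is 0.
Indeed a*a = 1 - h and aa* = 1 - q²h have the same spectrum away from 0, so the spectrum of h is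
stable under multiplication and division by q² except at the point 1.

Every element is a finite sum of monomials t_χ = a^(j) f(h) g^(d) u^(l), and t_χ* t_χ = F(h) for a
polynomial F computed in the `*`-algebra itself, hence the same in all representations
(`IsTriple.exists_star_term_mul_term`). In a representation φ₁ with φ₁(γ) ≠ 0, compress to the
eigenspace of h at q^(2k). Terms of the wrong a-degree vanish; averaging over conjugation by u and
then by g removes the wrong g-degrees and u-degrees, because the phase is not a root of unity. This
bounds |F(q^(2k))| by ‖φ₁(Σ t_χ)‖² for every k (`IsTriple.norm_eval_le`). In any other
representation φ₂, the norm of F(h) is at most the supremum of these values, so ‖φ₂(t_χ)‖ ≤ ‖φ₁(Σ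
t_χ)‖.

An element of length n needs at most (2n+1)³ monomials, which gives ‖φ₂(x)‖ ≤ (2n+1)³ ‖φ₁(x)‖.
Applied to the powers (x*x)^(2^n), this polynomial factor disappears, so φ₁ dominates φ₂
(`Pol.norm_le_norm`). Two representations that do not kill γ therefore induce the same norm, and
each is faithful since F cannot vanish at all q^(2k) unless f = 0
(`Pol.injective_of_map_gen_ne_zero`). Existence comes from an explicit representation on ℓ²(ℕ × ℤ)
(`exists_isTriple`). -/

/-- The defining relations of `Pol`, for elements `a`, `g`, `u` of an arbitrary `*`-algebra. -/
structure IsTriple {A : Type*} [Ring A] [StarRing A] [Algebra ℂ A] (q : ℝ) (c : ℂ) (a g u : A) :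
    Prop where
  normal : star g * g = g * star g
  gstar_a : (q : ℂ) • (star g * a) = a * star g
  g_a : (q : ℂ) • (g * a) = a * g
  sphere : star a * a + star g * g = 1
  sphere' : a * star a + ((q : ℂ) ^ 2) • (g * star g) = 1
  isometry : star u * u = 1
  coisometry : u * star u = 1
  u_g : star u * g * u = c • g
  u_a : star u * a * u = a

/-! ### Commutation up to a scalar -/

/-- `x` and `y` commute up to the scalar `c`. -/
def QComm {A : Type*} [Ring A] [Algebra ℂ A] (c : ℂ) (x y : A) : Prop := x * y = c • (y * x)

namespace QComm

variable {A : Type*} [Ring A] [Algebra ℂ A] {c d : ℂ} {x y z : A}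

theorem mul_right (h₁ : QComm c x y) (h₂ : QComm d x z) : QComm (c * d) x (y * z) := by
  unfold QComm at *
  rw [← mul_assoc, h₁, smul_mul_assoc, mul_assoc, h₂, mul_smul_comm, smul_smul, mul_assoc]

theorem mul_left (h₁ : QComm c x z) (h₂ : QComm d y z) : QComm (c * d) (x * y) z := by
  unfold QComm at *
  rw [mul_assoc, h₂, mul_smul_comm, ← mul_assoc, h₁, smul_mul_assoc, smul_smul, mul_assoc, mul_comm]

theorem one_right : QComm 1 x 1 := by simp [QComm]

theorem of_commute (h : Commute x y) : QComm 1 x y := by simpa [QComm] using h.eq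

theorem commute (h : QComm 1 x y) : Commute x y := by simpa [QComm, Commute, SemiconjBy] using h

theorem pow_right (h : QComm c x y) (n : ℕ) : QComm (c ^ n) x (y ^ n) := by
  induction n with
  | zero => simpa using one_right
  | succ n ih => rw [pow_succ, pow_succ]; exact ih.mul_right h

theorem symm (h : QComm c x y) (hc : c ≠ 0) : QComm c⁻¹ y x := by
  unfold QComm at *
  rw [h, smul_smul, inv_mul_cancel₀ hc, one_smul]

theorem star_star [StarRing A] [StarModule ℂ A] (h : QComm c x y) :
    QComm (star c) (star y) (star x) := by
  unfold QComm at *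
  rw [← star_mul, h, star_smul, star_mul]

end QComm

/-! ### Integer powers with the adjoint as inverse -/

/-- Integer powers, with `star x` in the role of the inverse of `x`. -/
def starZPow {A : Type*} [Monoid A] [Star A] (x : A) : ℤ → A
  | Int.ofNat n => x ^ n
  | Int.negSucc n => star x ^ (n + 1)

section starZPow

variable {A : Type*} [Ring A] [StarRing A]

theorem starZPow_natCast (x : A) (n : ℕ) : starZPow x n = x ^ n := rfl

theorem starZPow_zero (x : A) : starZPow x 0 = 1 := pow_zero x

theorem starZPow_neg_natCast (x : A) (n : ℕ) : starZPow x (-n) = star x ^ n := by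
  cases n with
  | zero => simp [starZPow_zero]
  | succ n => rfl

theorem star_starZPow (x : A) (n : ℤ) : star (starZPow x n) = starZPow x (-n) := by
  obtain ⟨n, rfl | rfl⟩ := n.eq_nat_or_neg
  · rw [starZPow_neg_natCast, starZPow_natCast, star_pow]
  · rw [neg_neg, starZPow_neg_natCast, starZPow_natCast, star_pow, star_star]

theorem QComm.starZPow_right [Algebra ℂ A] {c : ℂ} {x y : A} (h : QComm c x y)
    (h' : QComm c⁻¹ x (star y)) (n : ℤ) : QComm (c ^ n) x (starZPow y n) := by
  obtain ⟨n, rfl | rfl⟩ := n.eq_nat_or_neg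
  · simpa [starZPow_natCast] using h.pow_right n
  · simpa [starZPow_neg_natCast] using h'.pow_right n

/-- Either `x * x^(n) = x^(n+1)`, or `n` is negative and `x * star x` splits off. -/
theorem mul_starZPow_cases (x : A) (n : ℤ) :
    x * starZPow x n = starZPow x (n + 1) ∨
      ∃ k : ℕ, n + 1 = -k ∧ x * starZPow x n = x * star x * star x ^ k := by
  obtain ⟨n, rfl | rfl⟩ := n.eq_nat_or_neg
  · left
    rw [starZPow_natCast, ← pow_succ']
    rfl
  · cases n with
    | zero =>
      left
      simp only [Nat.cast_zero, neg_zero, starZPow_zero, mul_one, zero_add]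
      exact (pow_one x).symm
    | succ n =>
      right
      exact ⟨n, by push_cast; ring, by rw [starZPow_neg_natCast, pow_succ', mul_assoc]⟩

end starZPow

/-! ### Polynomials in an element that commutes up to scalars -/

section aeval

variable {A : Type*} [Ring A] [Algebra ℂ A]

theorem _root_.Commute.aeval_complex {x h : A} (H : Commute x h) (P : ℂ[X]) :
    Commute x (aeval h P) := by
  induction P using Polynomial.induction_on' with
  | add p r hp hr => rw [map_add]; exact hp.add_right hr
  | monomial n t =>
    rw [aeval_monomial]
    exact (show Commute x (algebraMap ℂ A t) from (Algebra.commutes t x).symm).mul_right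
      (H.pow_right n)

/-- Since h y = y (s h), moving y to the left rescales the variable of the polynomial by s. -/
theorem QComm.aeval_mul {s : ℂ} {h y : A} (H : QComm s h y) (P : ℂ[X]) :
    aeval h P * y = y * aeval h (P.comp (C s * X)) := by
  induction P using Polynomial.induction_on' with
  | add p r hp hr => rw [map_add, add_mul, hp, hr, add_comp, map_add, mul_add]
  | monomial n t =>
    have key : ∀ n : ℕ, h ^ n * y = y * (s • h) ^ n := by
      intro n
      induction n with
      | zero => simp
      | succ n ih =>
        rw [pow_succ, mul_assoc, H, mul_smul_comm, ← mul_assoc, ih, pow_succ, mul_smul_comm,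
          mul_smul_comm, mul_assoc]
    rw [aeval_monomial, monomial_comp, map_mul, map_pow, map_mul, aeval_C, aeval_C, aeval_X,
      mul_assoc, key, ← Algebra.smul_def, ← Algebra.smul_def, ← Algebra.smul_def, mul_smul_comm]

theorem star_aeval_of_isSelfAdjoint [StarRing A] [StarModule ℂ A] {h : A} (H : IsSelfAdjoint h)
    (P : ℂ[X]) : star (aeval h P) = aeval h (P.map (starRingEnd ℂ)) := by
  induction P using Polynomial.induction_on' with
  | add p r hp hr => rw [map_add, star_add, hp, hr, Polynomial.map_add, map_add]
  | monomial n t =>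
    rw [aeval_monomial, map_monomial, aeval_monomial, Algebra.commutes, star_mul, star_pow,
      H.star_eq, Algebra.algebraMap_eq_smul_one, Algebra.algebraMap_eq_smul_one, star_smul,
      star_one]
    simp

variable [StarRing A]

/-- For negative exponents a factor x x* = P(h) splits off, and it can be pushed to the right
through the powers of x*. Only the shift of the exponent matters later; R is left implicit. -/
theorem exists_mul_starZPow {s : ℂ} {x h : A} {P : ℂ[X]} (hx : x * star x = aeval h P)
    (hs : QComm s h (star x)) (n : ℤ) :
    ∃ R : ℂ[X], x * starZPow x n = starZPow x (n + 1) * aeval h R := by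
  obtain h1 | ⟨k, hk, h1⟩ := mul_starZPow_cases x n
  · exact ⟨1, by rw [h1, map_one, mul_one]⟩
  · exact ⟨_, by rw [h1, hx, (hs.pow_right k).aeval_mul, hk, starZPow_neg_natCast]⟩

/-- Peeling off the innermost x*x and moving it past x^n gives the product of the P(s^i X), i < n.
That this is nonzero is what faithfulness of representations rests on. -/
theorem exists_star_pow_mul_pow {s : ℂ} (hs0 : s ≠ 0) {x h : A} {P : ℂ[X]} (hP : P ≠ 0)
    (hx : star x * x = aeval h P) (hs : QComm s h x) (n : ℕ) :
    ∃ R : ℂ[X], R ≠ 0 ∧ star x ^ n * x ^ n = aeval h R := by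
  induction n with
  | zero => exact ⟨1, one_ne_zero, by simp⟩
  | succ n ih =>
    obtain ⟨R, hR, h1⟩ := ih
    refine ⟨R * P.comp (C (s ^ n) * X), mul_ne_zero hR ?_, ?_⟩
    · intro h0
      rw [comp_eq_zero_iff] at h0
      rcases h0 with h0 | h0
      · exact hP h0
      · have := congrArg (fun p => p.coeff 1) h0.2
        rw [coeff_C_mul, coeff_X_one, mul_one, coeff_C_succ] at this
        exact pow_ne_zero n hs0 this
    · rw [pow_succ, pow_succ', mul_assoc, ← mul_assoc (star x) x, hx, (hs.pow_right n).aeval_mul,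
        ← mul_assoc, h1, map_mul]

omit [Algebra ℂ A] in
theorem starZPow_star (x : A) (n : ℤ) : starZPow (star x) n = starZPow x (-n) := by
  obtain ⟨n, rfl | rfl⟩ := n.eq_nat_or_neg
  · rw [starZPow_neg_natCast, starZPow_natCast]
  · rw [neg_neg, starZPow_neg_natCast, starZPow_natCast, star_star]

theorem exists_star_starZPow_mul {s t : ℂ} (hs0 : s ≠ 0) (ht0 : t ≠ 0) {x h : A} {P Q : ℂ[X]}
    (hP : P ≠ 0) (hQ : Q ≠ 0) (hx : star x * x = aeval h P) (hx' : x * star x = aeval h Q)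
    (hs : QComm s h x) (ht : QComm t h (star x)) (n : ℤ) :
    ∃ R : ℂ[X], R ≠ 0 ∧ star (starZPow x n) * starZPow x n = aeval h R := by
  obtain ⟨n, rfl | rfl⟩ := n.eq_nat_or_neg
  · simpa only [starZPow_natCast, star_pow] using
      exists_star_pow_mul_pow hs0 hP hx hs n
  · simpa only [starZPow_neg_natCast, star_pow] using
      exists_star_pow_mul_pow ht0 hQ (by rwa [star_star]) ht n

omit [Algebra ℂ A] in
theorem commute_starZPow {x y : A} (h : Commute x y) (h' : Commute x (star y)) (n : ℤ) :
    Commute x (starZPow y n) := by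
  obtain ⟨n, rfl | rfl⟩ := n.eq_nat_or_neg
  · exact h.pow_right n
  · rw [starZPow_neg_natCast]; exact h'.pow_right n

end aeval

/-- The monomials `a^(j) f(g*g) g^(d) u^(l)`. -/
def term {A : Type*} [Ring A] [StarRing A] [Algebra ℂ A] (a g u : A) (χ : ℤ × ℤ × ℤ) (f : ℂ[X]) :
    A :=
  starZPow a χ.1 * aeval (star g * g) f * starZPow g χ.2.1 * starZPow u χ.2.2

namespace IsTriple

variable {A : Type*} [Ring A] [StarRing A] [Algebra ℂ A] [StarModule ℂ A]
  {q : ℝ} {c : ℂ} {a g u : A}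

omit [StarModule ℂ A] in
theorem map {B : Type*} [Ring B] [StarRing B] [Algebra ℂ B] (H : IsTriple q c a g u)
    (φ : A →⋆ₐ[ℂ] B) : IsTriple q c (φ a) (φ g) (φ u) where
  normal := by simpa only [map_mul, map_add, map_smul, map_star, map_one] using congrArg φ H.normal
  gstar_a := by simpa only [map_mul, map_add, map_smul, map_star, map_one] using congrArg φ H.gstar_a
  g_a := by simpa only [map_mul, map_add, map_smul, map_star, map_one] using congrArg φ H.g_a
  sphere := by simpa only [map_mul, map_add, map_smul, map_star, map_one] using congrArg φ H.sphere
  sphere' := by simpa only [map_mul, map_add, map_smul, map_star, map_one] using congrArg φ H.sphere'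
  isometry := by simpa only [map_mul, map_add, map_smul, map_star, map_one] using congrArg φ H.isometry
  coisometry := by simpa only [map_mul, map_add, map_smul, map_star, map_one] using congrArg φ H.coisometry
  u_g := by simpa only [map_mul, map_add, map_smul, map_star, map_one] using congrArg φ H.u_g
  u_a := by simpa only [map_mul, map_add, map_smul, map_star, map_one] using congrArg φ H.u_a

/-! ### Consequences of the defining relations -/

section relations

variable (H : IsTriple q c a g u)
include H
set_option linter.unusedSectionVars false

theorem g_qcomm_a (hq : q ≠ 0) : QComm (q : ℂ)⁻¹ g a := by
  unfold QComm
  rw [← H.g_a, smul_smul, inv_mul_cancel₀ (by exact_mod_cast hq), one_smul]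

theorem gstar_qcomm_a (hq : q ≠ 0) : QComm (q : ℂ)⁻¹ (star g) a := by
  unfold QComm
  rw [← H.gstar_a, smul_smul, inv_mul_cancel₀ (by exact_mod_cast hq), one_smul]

theorem g_qcomm_astar : QComm (q : ℂ) g (star a) := by
  have := congrArg star H.gstar_a
  simpa [QComm] using this.symm

theorem gstar_qcomm_astar : QComm (q : ℂ) (star g) (star a) := by
  have := congrArg star H.g_a
  simpa [QComm] using this.symm

theorem g_qcomm_u : QComm c g u := by
  unfold QComm
  rw [← mul_smul_comm, ← H.u_g, ← mul_assoc, ← mul_assoc, H.coisometry, one_mul]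

theorem u_commute_a : Commute u a := by
  unfold Commute SemiconjBy
  conv_lhs => rw [← H.u_a]
  rw [← mul_assoc, ← mul_assoc, H.coisometry, one_mul]

theorem g_qcomm_ustar (hc : c ≠ 0) : QComm c⁻¹ g (star u) := by
  have h : star u * g = c • (g * star u) := by
    have := congrArg (· * star u) H.g_qcomm_u
    simp only [mul_assoc, H.coisometry, mul_one, smul_mul_assoc] at this
    calc star u * g = star u * (c • (u * (g * star u))) := by rw [← this]
      _ = _ := by rw [mul_smul_comm, ← mul_assoc, H.isometry, one_mul]
  unfold QComm
  rw [h, smul_smul, inv_mul_cancel₀ hc, one_smul]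

theorem gstar_qcomm_u (hc : ‖c‖ = 1) : QComm c⁻¹ (star g) u := by
  have hc0 : c ≠ 0 := by rintro rfl; simp at hc
  have := ((H.g_qcomm_ustar hc0).star_star).symm (by simpa using hc0)
  simpa [Complex.inv_eq_conj hc] using this

theorem gstar_qcomm_ustar (hc : ‖c‖ = 1) : QComm c (star g) (star u) := by
  have hc0 : c ≠ 0 := by rintro rfl; simp at hc
  have := (H.g_qcomm_u.star_star).symm (by simpa using hc0)
  simpa [← Complex.inv_eq_conj hc] using this

theorem u_commute_of_commute_star {x : A} (h : Commute (star u) x) : Commute u x := by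
  have h1 : u * (star u * x) * u = u * (x * star u) * u := by rw [h.eq]
  rw [← mul_assoc, H.coisometry, one_mul, mul_assoc, mul_assoc, H.isometry, mul_one] at h1
  exact h1.symm

theorem u_commute_astar : Commute u (star a) :=
  H.u_commute_of_commute_star (by have := congrArg star H.u_commute_a.eq; simpa [Commute, SemiconjBy] using this.symm)

theorem u_qcomm_g (hc : ‖c‖ = 1) : QComm c⁻¹ u g :=
  H.g_qcomm_u.symm (by rintro rfl; simp at hc)

theorem u_qcomm_gstar (hc : ‖c‖ = 1) : QComm c u (star g) := by
  simpa using (H.gstar_qcomm_u hc).symm (inv_ne_zero (by rintro rfl; simp at hc))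

theorem h_qcomm_a (hq : q ≠ 0) : QComm ((q : ℂ)⁻¹ * (q : ℂ)⁻¹) (star g * g) a :=
  (H.gstar_qcomm_a hq).mul_left (H.g_qcomm_a hq)

theorem h_qcomm_astar : QComm ((q : ℂ) * q) (star g * g) (star a) :=
  H.gstar_qcomm_astar.mul_left H.g_qcomm_astar

theorem h_commute_g : Commute (star g * g) g := by
  unfold Commute SemiconjBy
  rw [← mul_assoc, H.normal]

theorem h_commute_gstar : Commute (star g * g) (star g) := by
  unfold Commute SemiconjBy
  rw [mul_assoc, ← H.normal]

theorem h_commute_u (hc : ‖c‖ = 1) : Commute (star g * g) u := by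
  have hc0 : c ≠ 0 := by rintro rfl; simp at hc
  have := (H.gstar_qcomm_u hc).mul_left H.g_qcomm_u
  rw [inv_mul_cancel₀ hc0] at this
  exact this.commute

theorem h_commute_ustar (hc : ‖c‖ = 1) : Commute (star g * g) (star u) := by
  have h := congrArg star (H.h_commute_u hc).eq
  simpa [Commute, SemiconjBy] using h.symm

theorem a_mul_astar : a * star a = aeval (star g * g) (1 - C ((q : ℂ) ^ 2) * X : ℂ[X]) := by
  rw [map_sub, map_mul, aeval_C, aeval_X, map_one, H.normal, ← Algebra.smul_def]
  exact eq_sub_of_add_eq H.sphere'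

theorem astar_mul_a : star a * a = aeval (star g * g) (1 - X : ℂ[X]) := by
  rw [map_sub, aeval_X, map_one]
  exact eq_sub_of_add_eq H.sphere

end relations

/-! ### Monomials: commutation, multiplication by letters, and their squares -/

section term

variable (H : IsTriple q c a g u) (hq : q ≠ 0) (hc : ‖c‖ = 1) (χ : ℤ × ℤ × ℤ) (f : ℂ[X])
set_option linter.unusedSectionVars false
include H hc

/-- Commutation scalars recover the multidegree: u sees the g-degree, g and g* together see the
a-degree (their scalars multiply to a power of q⁻²), and g* then sees the u-degree. -/
theorem u_qcomm_term : QComm (c⁻¹ ^ χ.2.1) u (term a g u χ f) := by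
  have h1 := (commute_starZPow H.u_commute_a H.u_commute_astar χ.1).mul_right
    ((H.h_commute_u hc).symm.aeval_complex f)
  have h2 := (H.u_qcomm_g hc).starZPow_right (by simpa using H.u_qcomm_gstar hc) χ.2.1
  have h3 : Commute u (starZPow u χ.2.2) := commute_starZPow (Commute.refl u)
    (by rw [Commute, SemiconjBy, H.isometry, H.coisometry]) _
  have := ((QComm.of_commute h1).mul_right h2).mul_right (QComm.of_commute h3)
  simpa only [one_mul, mul_one, term] using this

include hq

theorem g_qcomm_term : QComm ((q : ℂ)⁻¹ ^ χ.1 * c ^ χ.2.2) g (term a g u χ f) := by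
  have h1 := (H.g_qcomm_a hq).starZPow_right (by simpa using H.g_qcomm_astar) χ.1
  have h2 := QComm.of_commute (H.h_commute_g.symm.aeval_complex f)
  have h3 := QComm.of_commute (commute_starZPow (Commute.refl g) H.normal.symm χ.2.1)
  have h4 := H.g_qcomm_u.starZPow_right (H.g_qcomm_ustar (by rintro rfl; simp at hc)) χ.2.2
  have := ((h1.mul_right h2).mul_right h3).mul_right h4
  simpa only [one_mul, mul_one, term] using this

theorem gstar_qcomm_term : QComm ((q : ℂ)⁻¹ ^ χ.1 * c⁻¹ ^ χ.2.2) (star g) (term a g u χ f) := by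
  have h1 := (H.gstar_qcomm_a hq).starZPow_right (by simpa using H.gstar_qcomm_astar) χ.1
  have h2 := QComm.of_commute (H.h_commute_gstar.symm.aeval_complex f)
  have h3 := QComm.of_commute (commute_starZPow H.normal (Commute.refl (star g)) χ.2.1)
  have h4 := (H.gstar_qcomm_u hc).starZPow_right (by simpa using H.gstar_qcomm_ustar hc) χ.2.2
  have := ((h1.mul_right h2).mul_right h3).mul_right h4
  simpa only [one_mul, mul_one, term] using this

omit hc

omit hq in
-- This and its analogues for the other letters say that left multiplication by a letter moves the
-- multidegree by one step and keeps a single monomial, with any scalars and polynomial factors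
-- absorbed into f.
theorem exists_a_mul_term :
    ∃ f', a * term a g u χ f = term a g u (χ.1 + 1, χ.2.1, χ.2.2) f' := by
  obtain ⟨R, hR⟩ := exists_mul_starZPow H.a_mul_astar H.h_qcomm_astar χ.1
  refine ⟨R * f, ?_⟩
  simp only [term, map_mul, ← mul_assoc, hR]

theorem exists_astar_mul_term :
    ∃ f', star a * term a g u χ f = term a g u (χ.1 - 1, χ.2.1, χ.2.2) f' := by
  obtain ⟨R, hR⟩ := exists_mul_starZPow (x := star a) (by rw [star_star]; exact H.astar_mul_a)
    (by rw [star_star]; exact H.h_qcomm_a hq) (-χ.1)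
  refine ⟨R * f, ?_⟩
  rw [starZPow_star, starZPow_star, neg_neg, neg_add, neg_neg] at hR
  simp only [term, map_mul, ← mul_assoc, hR, sub_eq_add_neg]

theorem exists_g_mul_term :
    ∃ f', g * term a g u χ f = term a g u (χ.1, χ.2.1 + 1, χ.2.2) f' := by
  obtain ⟨R, hR⟩ := exists_mul_starZPow (x := g) (h := star g * g) (P := X) (s := 1)
    (by rw [aeval_X, H.normal]) (QComm.of_commute H.h_commute_gstar) χ.2.1
  have hR' : Commute (aeval (star g * g) R) (starZPow g (χ.2.1 + 1)) :=
    commute_starZPow (H.h_commute_g.symm.aeval_complex R).symm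
      (H.h_commute_gstar.symm.aeval_complex R).symm _
  have h1 := ((H.g_qcomm_a hq).starZPow_right (by simpa using H.g_qcomm_astar) χ.1).mul_right
    (QComm.of_commute (H.h_commute_g.symm.aeval_complex f))
  refine ⟨C ((q : ℂ)⁻¹ ^ χ.1) * (f * R), ?_⟩
  simp only [term]
  rw [← mul_assoc, ← mul_assoc, h1, mul_one, smul_mul_assoc, mul_assoc _ g, hR, ← hR'.eq,
    map_mul, aeval_C, ← Algebra.smul_def, map_mul]
  simp only [mul_assoc, mul_smul_comm, smul_mul_assoc]

theorem exists_gstar_mul_term :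
    ∃ f', star g * term a g u χ f = term a g u (χ.1, χ.2.1 - 1, χ.2.2) f' := by
  obtain ⟨R, hR⟩ := exists_mul_starZPow (x := star g) (h := star g * g) (P := X) (s := 1)
    (by rw [aeval_X, star_star]) (by rw [star_star]; exact QComm.of_commute H.h_commute_g) (-χ.2.1)
  rw [starZPow_star, starZPow_star, neg_neg, neg_add, neg_neg, ← sub_eq_add_neg] at hR
  have hR' : Commute (aeval (star g * g) R) (starZPow g (χ.2.1 - 1)) :=
    commute_starZPow (H.h_commute_g.symm.aeval_complex R).symm
      (H.h_commute_gstar.symm.aeval_complex R).symm _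
  have h1 := ((H.gstar_qcomm_a hq).starZPow_right (by simpa using H.gstar_qcomm_astar)
    χ.1).mul_right (QComm.of_commute (H.h_commute_gstar.symm.aeval_complex f))
  refine ⟨C ((q : ℂ)⁻¹ ^ χ.1) * (f * R), ?_⟩
  simp only [term]
  rw [← mul_assoc, ← mul_assoc, h1, mul_one, smul_mul_assoc, mul_assoc _ (star g), hR, ← hR'.eq,
    map_mul, aeval_C, ← Algebra.smul_def, map_mul]
  simp only [mul_assoc, mul_smul_comm, smul_mul_assoc]

omit hq
theorem u_mul_starZPow (n : ℤ) : u * starZPow u n = starZPow u (n + 1) := by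
  obtain h | ⟨k, hk, h⟩ := mul_starZPow_cases u n
  · exact h
  · rw [h, hk, starZPow_neg_natCast, H.coisometry, one_mul]

theorem ustar_mul_starZPow (n : ℤ) : star u * starZPow u n = starZPow u (n - 1) := by
  rw [← sub_add_cancel n 1, ← H.u_mul_starZPow, ← mul_assoc, H.isometry, one_mul, sub_add_cancel]

theorem exists_u_mul_term (hc : ‖c‖ = 1) :
    ∃ f', u * term a g u χ f = term a g u (χ.1, χ.2.1, χ.2.2 + 1) f' := by
  have h1 := (commute_starZPow H.u_commute_a H.u_commute_astar χ.1).mul_right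
    ((H.h_commute_u hc).symm.aeval_complex f)
  have h2 := (H.u_qcomm_g hc).starZPow_right (by simpa using H.u_qcomm_gstar hc) χ.2.1
  refine ⟨C (c⁻¹ ^ χ.2.1) * f, ?_⟩
  simp only [term]
  rw [← mul_assoc, (QComm.of_commute h1).mul_right h2, one_mul, smul_mul_assoc, mul_assoc _ u,
    H.u_mul_starZPow, map_mul, aeval_C, ← Algebra.smul_def]
  simp only [mul_assoc, mul_smul_comm, smul_mul_assoc]

theorem exists_ustar_mul_term (hc : ‖c‖ = 1) :
    ∃ f', star u * term a g u χ f = term a g u (χ.1, χ.2.1, χ.2.2 - 1) f' := by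
  have h1 := (commute_starZPow (by simpa [Commute, SemiconjBy] using congrArg star H.u_commute_astar.eq.symm)
    (by simpa [Commute, SemiconjBy] using congrArg star H.u_commute_a.eq.symm) χ.1).mul_right
    ((H.h_commute_ustar hc).symm.aeval_complex f)
  have hc0 : c ≠ 0 := by rintro rfl; simp at hc
  have h2 := ((H.g_qcomm_ustar hc0).symm (inv_ne_zero hc0)).starZPow_right
    ((H.gstar_qcomm_ustar hc).symm hc0 |> fun h => by simpa using h) χ.2.1
  refine ⟨C (c ^ χ.2.1) * f, ?_⟩
  simp only [term]
  rw [← mul_assoc, (QComm.of_commute h1).mul_right h2, one_mul, smul_mul_assoc,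
    mul_assoc _ (star u), H.ustar_mul_starZPow, map_mul, aeval_C, ← Algebra.smul_def]
  simp only [mul_assoc, mul_smul_comm, smul_mul_assoc, inv_inv]

/-- The powers of u cancel, those of g and a collapse to polynomials in h, and everything left
commutes. P depends on χ but not on f, and it is nonzero, so the square determines whether f
vanishes. -/
theorem exists_star_term_mul_term (hq : q ≠ 0) (hc : ‖c‖ = 1) :
    ∃ P : ℂ[X], P ≠ 0 ∧ ∀ f, star (term a g u χ f) * term a g u χ f =
      aeval (star g * g) (f.map (starRingEnd ℂ) * f * P) := by
  have hc0 : c ≠ 0 := by rintro rfl; simp at hc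
  have hq0 : (q : ℂ) ≠ 0 := by exact_mod_cast hq
  obtain ⟨P, hP0, hP⟩ := exists_star_starZPow_mul (s := (q : ℂ)⁻¹ * (q : ℂ)⁻¹) (t := (q : ℂ) * q)
    (by simpa) (by simpa) (P := 1 - X) (Q := 1 - C ((q : ℂ) ^ 2) * X)
    (fun h => by simpa using congrArg (eval 0) h)
    (fun h => by simpa using congrArg (eval 0) h)
    H.astar_mul_a H.a_mul_astar (H.h_qcomm_a hq) H.h_qcomm_astar χ.1
  obtain ⟨R, hR0, hR⟩ := exists_star_starZPow_mul (x := g) (h := star g * g) one_ne_zero one_ne_zero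
    (P := X) (Q := X) X_ne_zero X_ne_zero (aeval_X _).symm (by rw [aeval_X, H.normal])
    (QComm.of_commute H.h_commute_g) (QComm.of_commute H.h_commute_gstar) χ.2.1
  have hU : star (starZPow u χ.2.2) * starZPow u χ.2.2 = 1 := by
    rw [star_starZPow]
    obtain ⟨n, hn | hn⟩ := χ.2.2.eq_nat_or_neg
    · rw [hn, starZPow_neg_natCast, starZPow_natCast]
      exact (show Commute (star u) u by rw [Commute, SemiconjBy, H.isometry, H.coisometry]).mul_pow n
        ▸ by rw [H.isometry, one_pow]
    · rw [hn, neg_neg, starZPow_neg_natCast, starZPow_natCast]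
      exact (show Commute u (star u) by rw [Commute, SemiconjBy, H.isometry, H.coisometry]).mul_pow n
        ▸ by rw [H.coisometry, one_pow]
  refine ⟨P * R, mul_ne_zero hP0 hR0, fun f => ?_⟩
  have hsa : IsSelfAdjoint (star g * g) := IsSelfAdjoint.star_mul_self g
  have cG : ∀ F : ℂ[X], Commute (aeval (star g * g) F) (starZPow g χ.2.1) := fun F =>
    commute_starZPow (H.h_commute_g.symm.aeval_complex F).symm
      (H.h_commute_gstar.symm.aeval_complex F).symm _
  have cU : ∀ F : ℂ[X], Commute (aeval (star g * g) F) (starZPow u χ.2.2) := fun F =>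
    commute_starZPow ((H.h_commute_u hc).symm.aeval_complex F).symm
      ((H.h_commute_ustar hc).symm.aeval_complex F).symm _
  set A' := starZPow a χ.1
  set G := starZPow g χ.2.1
  set U := starZPow u χ.2.2
  set h := star g * g
  calc star (A' * aeval h f * G * U) * (A' * aeval h f * G * U)
      = star U * (star G * (star (aeval h f) * (star A' * A') * aeval h f * G) * U) := by
        simp only [star_mul, mul_assoc]
    _ = star U * ((star G * G) * aeval h (f.map (starRingEnd ℂ) * P * f) * U) := by
        rw [hP, star_aeval_of_isSelfAdjoint hsa, ← map_mul, ← map_mul, (cG _).eq]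
        simp only [mul_assoc]
    _ = star U * (U * aeval h (R * (f.map (starRingEnd ℂ) * P * f))) := by
        rw [hR, ← map_mul, (cU _).eq]
    _ = _ := by
        rw [← mul_assoc, hU, one_mul]
        congr 1
        ring

end term

end IsTriple

/-! ### Sums of monomials and their images under homomorphisms -/

section termSum

variable {A : Type*} [Ring A] [StarRing A] [Algebra ℂ A] (a g u : A) (χ : ℤ × ℤ × ℤ)

theorem term_add (f f' : ℂ[X]) : term a g u χ (f + f') = term a g u χ f + term a g u χ f' := by
  simp only [term, map_add, mul_add, add_mul]

theorem term_smul (t : ℂ) (f : ℂ[X]) : term a g u χ (t • f) = t • term a g u χ f := by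
  simp only [term, map_smul, mul_smul_comm, smul_mul_assoc]

theorem term_zero : term a g u χ 0 = 0 := by
  simp only [term, map_zero, mul_zero, zero_mul]

theorem map_starZPow {B : Type*} [Ring B] [StarRing B] [Algebra ℂ B] (φ : A →⋆ₐ[ℂ] B) (x : A)
    (n : ℤ) : φ (starZPow x n) = starZPow (φ x) n := by
  obtain ⟨n, rfl | rfl⟩ := n.eq_nat_or_neg
  · rw [starZPow_natCast, starZPow_natCast, map_pow]
  · rw [starZPow_neg_natCast, starZPow_neg_natCast, map_pow, map_star]

theorem map_aeval_star_mul {B : Type*} [Ring B] [StarRing B] [Algebra ℂ B] (φ : A →⋆ₐ[ℂ] B) (x : A)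
    (f : ℂ[X]) : φ (aeval (star x * x) f) = aeval (star (φ x) * φ x) f := by
  rw [← map_star, ← map_mul]
  exact (aeval_algHom_apply φ.toAlgHom (star x * x) f).symm

theorem map_term {B : Type*} [Ring B] [StarRing B] [Algebra ℂ B] (φ : A →⋆ₐ[ℂ] B) (f : ℂ[X]) :
    φ (term a g u χ f) = term (φ a) (φ g) (φ u) χ f := by
  simp only [term, map_mul, map_starZPow, map_aeval_star_mul]

/-- The multidegrees with all entries of modulus at most `n`. -/
def degreeBox (n : ℕ) : Finset (ℤ × ℤ × ℤ) :=
  Finset.Icc (-n : ℤ) n ×ˢ Finset.Icc (-n : ℤ) n ×ˢ Finset.Icc (-n : ℤ) n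

theorem mem_degreeBox {n : ℕ} {χ : ℤ × ℤ × ℤ} : χ ∈ degreeBox n ↔
    (-(n : ℤ) ≤ χ.1 ∧ χ.1 ≤ n) ∧ (-(n : ℤ) ≤ χ.2.1 ∧ χ.2.1 ≤ n) ∧
      (-(n : ℤ) ≤ χ.2.2 ∧ χ.2.2 ≤ n) := by
  simp [degreeBox, Finset.mem_product, Finset.mem_Icc]

theorem card_degreeBox (n : ℕ) : (degreeBox n).card = (2 * n + 1) ^ 3 := by
  have : ((n : ℤ) + 1 - -n).toNat = 2 * n + 1 := by omega
  simp only [degreeBox, Finset.card_product, Int.card_Icc, this]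
  ring

/-- The span of the monomials with multidegree in `degreeBox n`. -/
def termSpan (n : ℕ) : Submodule ℂ A :=
  Submodule.span ℂ {x | ∃ χ ∈ degreeBox n, ∃ f, x = term a g u χ f}

theorem exists_sum_of_mem_termSpan {n : ℕ} {x : A} (hx : x ∈ termSpan a g u n) :
    ∃ f : ℤ × ℤ × ℤ → ℂ[X], x = ∑ χ ∈ degreeBox n, term a g u χ (f χ) := by
  classical
  induction hx using Submodule.span_induction with
  | mem x h =>
    obtain ⟨χ, hχ, f, rfl⟩ := h
    refine ⟨Pi.single χ f, ?_⟩
    rw [Finset.sum_eq_single χ, Pi.single_eq_same]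
    · intro χ' _ h
      rw [Pi.single_eq_of_ne h, term_zero]
    · exact fun h => (h hχ).elim
  | zero => exact ⟨0, by simp [term_zero]⟩
  | add x y _ _ hx hy =>
    obtain ⟨f, rfl⟩ := hx
    obtain ⟨f', rfl⟩ := hy
    exact ⟨f + f', by simp only [Pi.add_apply, term_add, Finset.sum_add_distrib]⟩
  | smul t x _ hx =>
    obtain ⟨f, rfl⟩ := hx
    exact ⟨t • f, by simp only [Pi.smul_apply, term_smul, Finset.smul_sum]⟩

theorem term_mem_termSpan {n : ℕ} {χ : ℤ × ℤ × ℤ} (h : χ ∈ degreeBox n) (f : ℂ[X]) :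
    term a g u χ f ∈ termSpan a g u n := Submodule.subset_span ⟨χ, h, f, rfl⟩

end termSum

/-! ### The presented algebra and its universal property -/

namespace Pol

variable {q θ : ℝ}

/-- The value of a letter under an assignment of the generators. -/
def genVal {B : Type*} (a g u : B) : Gen → B
  | .α => a
  | .γ => g
  | .u => u

variable (q θ) in
/-- The generators of `Pol q θ`. -/
def gen (x : Gen) : Pol q θ := mk (FreeStarAlgebra.of x)

/-- The scalar `exp(2πiθ)`. -/
def phase (θ : ℝ) : ℂ := Complex.exp (2 * Real.pi * Complex.I * θ)

theorem norm_phase (θ : ℝ) : ‖phase θ‖ = 1 := by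
  rw [phase, show (2 * Real.pi * Complex.I * θ : ℂ) = ((2 * Real.pi * θ : ℝ) : ℂ) * Complex.I by
    push_cast; ring]
  exact Complex.norm_exp_ofReal_mul_I _

theorem phase_zpow_ne_one (hθ : Irrational θ) {n : ℤ} (hn : n ≠ 0) : phase θ ^ n ≠ 1 := by
  intro h
  rw [phase, ← Complex.exp_int_mul, Complex.exp_eq_one_iff] at h
  obtain ⟨m, hm⟩ := h
  have h1 : (n : ℂ) * θ = m := by
    have h2 : (2 * Real.pi * Complex.I : ℂ) ≠ 0 := Complex.two_pi_I_ne_zero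
    apply mul_right_cancel₀ h2
    rw [← hm]
    ring
  have h3 : (n : ℝ) * θ = m := by exact_mod_cast h1
  exact (hθ.intCast_mul hn).ne_int m h3

theorem mk_rel {x y : FreeStarAlgebra Gen} (h : PolRel q θ x y) :
    mk (q := q) (θ := θ) x = mk y := RingQuot.mkAlgHom_rel ℂ h

theorem isTriple_gen : IsTriple q (phase θ) (gen q θ .α) (gen q θ .γ) (gen q θ .u) where
  normal := by
    simpa only [gen, phase, map_mul, mk_star] using mk_rel (PolRel.γ_normal (q := q) (θ := θ))
  gstar_a := by
    simpa only [gen, phase, map_mul, mk_star, map_smul] using mk_rel (PolRel.γstar_α (q := q) (θ := θ))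
  g_a := by
    simpa only [gen, phase, map_mul, mk_star, map_smul] using mk_rel (PolRel.γ_α (q := q) (θ := θ))
  sphere := by
    simpa only [gen, phase, map_mul, mk_star, map_smul, map_add, map_one] using
      mk_rel (PolRel.sphere (q := q) (θ := θ))
  sphere' := by
    simpa only [gen, phase, map_mul, mk_star, map_smul, map_add, map_one] using
      mk_rel (PolRel.sphere' (q := q) (θ := θ))
  isometry := by
    simpa only [gen, phase, map_mul, mk_star, map_one] using mk_rel (PolRel.u_isometry (q := q) (θ := θ))
  coisometry := by
    simpa only [gen, phase, map_mul, mk_star, map_one] using mk_rel (PolRel.u_coisometry (q := q) (θ := θ))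
  u_g := by
    simpa only [gen, phase, map_mul, mk_star, map_smul] using mk_rel (PolRel.u_γ (q := q) (θ := θ))
  u_a := by
    simpa only [gen, phase, map_mul, mk_star] using mk_rel (PolRel.u_α (q := q) (θ := θ))

section lift

variable {B : Type*} [Ring B] [StarRing B] [Algebra ℂ B] [StarModule ℂ B]

/-- The homomorphism from the free `*`-algebra given by the images of the generators. -/
def freeLift (a g u : B) : FreeStarAlgebra Gen →ₐ[ℂ] B :=
  FreeAlgebra.lift ℂ (Sum.elim (genVal a g u) (fun x => star (genVal a g u x)))

omit [StarModule ℂ B] in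
theorem freeLift_letter (a g u : B) (y : Gen ⊕ Gen) :
    freeLift a g u (FreeStarAlgebra.letter y) =
      Sum.elim (genVal a g u) (fun x => star (genVal a g u x)) y :=
  FreeAlgebra.lift_ι_apply _ _

omit [StarModule ℂ B] in
theorem freeLift_of (a g u : B) (x : Gen) :
    freeLift a g u (FreeStarAlgebra.of x) = genVal a g u x := freeLift_letter a g u _

theorem freeLift_star (a g u : B) (x : FreeStarAlgebra Gen) :
    freeLift a g u (star x) = star (freeLift a g u x) := by
  induction x using FreeAlgebra.induction with
  | grade0 t =>
    refine (congrArg _ (FreeStarAlgebra.star_algebraMap t)).trans ?_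
    refine ((freeLift a g u).commutes _).trans ?_
    refine Eq.trans ?_ (congrArg star ((freeLift a g u).commutes t).symm)
    rw [Algebra.algebraMap_eq_smul_one, Algebra.algebraMap_eq_smul_one, star_smul, star_one]
  | grade1 y =>
    refine (congrArg _ (FreeStarAlgebra.star_letter y)).trans ?_
    refine (freeLift_letter a g u _).trans ?_
    refine Eq.trans ?_ (congrArg star (freeLift_letter a g u y).symm)
    cases y <;> simp
  | mul x y hx hy =>
    refine (congrArg _ (FreeStarAlgebra.star_mul_aux x y)).trans ?_
    refine (map_mul (freeLift a g u) _ _).trans ?_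
    rw [hx, hy, ← star_mul]
    exact congrArg star (map_mul (freeLift a g u) x y).symm
  | add x y hx hy =>
    refine (congrArg _ (FreeStarAlgebra.star_add_aux x y)).trans ?_
    refine (map_add (freeLift a g u) _ _).trans ?_
    rw [hx, hy, ← star_add]
    exact congrArg star (map_add (freeLift a g u) x y).symm

theorem freeLift_rel {a g u : B} (H : IsTriple q (phase θ) a g u) {x y : FreeStarAlgebra Gen}
    (h : PolRel q θ x y) : freeLift a g u x = freeLift a g u y := by
  induction h with
  | γ_normal => simpa only [map_mul, freeLift_star, freeLift_of, genVal, phase] using H.normal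
  | γstar_α => simpa only [map_mul, map_smul, freeLift_star, freeLift_of, genVal, phase] using H.gstar_a
  | γ_α => simpa only [map_mul, map_smul, freeLift_star, freeLift_of, genVal, phase] using H.g_a
  | sphere =>
    simpa only [map_mul, map_add, map_one, freeLift_star, freeLift_of, genVal, phase] using H.sphere
  | sphere' =>
    simpa only [map_mul, map_smul, map_add, map_one, freeLift_star, freeLift_of, genVal, phase] using H.sphere'
  | u_isometry => simpa only [map_mul, map_one, freeLift_star, freeLift_of, genVal, phase] using H.isometry
  | u_coisometry => simpa only [map_mul, map_one, freeLift_star, freeLift_of, genVal, phase] using H.coisometry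
  | u_γ => simpa only [map_mul, map_smul, freeLift_star, freeLift_of, genVal, phase] using H.u_g
  | u_α => simpa only [map_mul, map_smul, freeLift_star, freeLift_of, genVal, phase] using H.u_a
  | adjoint _ ih => rw [freeLift_star, freeLift_star, ih]

/-- The universal property of `Pol q θ`. -/
def lift {a g u : B} (H : IsTriple q (phase θ) a g u) : Pol q θ →⋆ₐ[ℂ] B :=
  let φ : Pol q θ →ₐ[ℂ] B := RingQuot.liftAlgHom ℂ ⟨freeLift a g u, fun _ _ h => freeLift_rel H h⟩
  have hφ : ∀ x, φ (mk x) = freeLift a g u x := fun x =>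
    RingQuot.liftAlgHom_mkAlgHom_apply ℂ (freeLift a g u) (fun _ _ h => freeLift_rel H h) x
  { φ with
    map_star' := fun x => by
      obtain ⟨x, rfl⟩ := mk_surjective x
      exact (congrArg φ (mk_star x)).symm.trans ((hφ _).trans ((freeLift_star a g u x).trans
        (congrArg star (hφ x)).symm)) }

theorem lift_gen {a g u : B} (H : IsTriple q (phase θ) a g u) (x : Gen) :
    lift H (gen q θ x) = genVal a g u x :=
  (RingQuot.liftAlgHom_mkAlgHom_apply ℂ (freeLift a g u) (fun _ _ h => freeLift_rel H h) _).trans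
    (freeLift_of a g u x)

end lift

/-! ### Filtration by word length -/

section filtration

variable (q θ) in
/-- The span of the unit and the letters. -/
def letterSpan : Submodule ℂ (Pol q θ) :=
  Submodule.span ℂ (insert 1 (Set.range fun y => mk (FreeStarAlgebra.letter y)))

theorem one_le_letterSpan : 1 ≤ letterSpan q θ := by
  rw [Submodule.one_le]
  exact Submodule.subset_span (Set.mem_insert _ _)

/-- The unit lies in `letterSpan`, so its powers increase. Filtering by powers of one subspace makes
the length of x^N at most N times that of x, as needed for the final power trick. -/
theorem exists_mem_letterSpan_pow (x : Pol q θ) : ∃ n, x ∈ letterSpan q θ ^ n := by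
  have mono : ∀ {m n : ℕ}, m ≤ n → letterSpan q θ ^ m ≤ letterSpan q θ ^ n := fun h =>
    pow_le_pow_right' one_le_letterSpan h
  obtain ⟨x, rfl⟩ := mk_surjective x
  induction x using FreeAlgebra.induction with
  | grade0 t =>
    refine ⟨0, ?_⟩
    rw [pow_zero]
    exact Submodule.mem_one.2 ⟨t, (mk.commutes t).symm⟩
  | grade1 y =>
    refine ⟨1, ?_⟩
    rw [pow_one]
    exact Submodule.subset_span (Set.mem_insert_of_mem _ ⟨y, rfl⟩)
  | mul x y hx hy =>
    obtain ⟨m, hm⟩ := hx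
    obtain ⟨n, hn⟩ := hy
    refine ⟨m + n, ?_⟩
    rw [pow_add]
    exact (map_mul mk x y).symm ▸ Submodule.mul_mem_mul hm hn
  | add x y hx hy =>
    obtain ⟨m, hm⟩ := hx
    obtain ⟨n, hn⟩ := hy
    refine ⟨m + n, ?_⟩
    exact (map_add mk x y).symm ▸
      Submodule.add_mem _ (mono (Nat.le_add_right m n) hm) (mono (Nat.le_add_left n m) hn)

variable (q θ) in
/-- The span of the normally ordered monomials with multidegree in `degreeBox n`. -/
def normalSpan (n : ℕ) : Submodule ℂ (Pol q θ) :=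
  termSpan (gen q θ .α) (gen q θ .γ) (gen q θ .u) n

theorem letterSpan_mul_normalSpan_le (hq : q ≠ 0) (n : ℕ) :
    letterSpan q θ * normalSpan q θ n ≤ normalSpan q θ (n + 1) := by
  rw [letterSpan, normalSpan, termSpan, Submodule.span_mul_span, Submodule.span_le]
  rintro _ ⟨s, hs, _, ⟨χ, hχ, f, rfl⟩, rfl⟩
  have H := isTriple_gen (q := q) (θ := θ)
  have hc := norm_phase θ
  rw [mem_degreeBox] at hχ
  have key : ∀ χ' : ℤ × ℤ × ℤ, (∃ f', s * term (gen q θ .α) (gen q θ .γ) (gen q θ .u) χ f =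
      term (gen q θ .α) (gen q θ .γ) (gen q θ .u) χ' f') → χ' ∈ degreeBox (n + 1) →
      s * term (gen q θ .α) (gen q θ .γ) (gen q θ .u) χ f ∈ normalSpan q θ (n + 1) := by
    rintro χ' ⟨f', hf'⟩ h
    rw [hf']
    exact term_mem_termSpan _ _ _ h f'
  rcases hs with rfl | ⟨y, rfl⟩
  · refine key χ ⟨f, one_mul _⟩ ?_
    rw [mem_degreeBox]; push_cast; omega
  · have hstar : ∀ x : Gen, mk (q := q) (θ := θ) (FreeStarAlgebra.letter (Sum.inr x)) =
        star (gen q θ x) := fun x => by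
      rw [gen, ← mk_star, FreeStarAlgebra.star_of]; rfl
    rcases y with (_ | _ | _) | (_ | _ | _)
    · exact key _ (H.exists_a_mul_term χ f) (by rw [mem_degreeBox]; push_cast; omega)
    · exact key _ (H.exists_g_mul_term hq χ f)
        (by rw [mem_degreeBox]; push_cast; omega)
    · exact key _ (H.exists_u_mul_term χ f hc)
        (by rw [mem_degreeBox]; push_cast; omega)
    · simp only [hstar] at key ⊢
      exact key _ (H.exists_astar_mul_term hq χ f)
        (by rw [mem_degreeBox]; push_cast; omega)
    · simp only [hstar] at key ⊢
      exact key _ (H.exists_gstar_mul_term hq χ f)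
        (by rw [mem_degreeBox]; push_cast; omega)
    · simp only [hstar] at key ⊢
      exact key _ (H.exists_ustar_mul_term χ f hc)
        (by rw [mem_degreeBox]; push_cast; omega)

/-- Each further letter enlarges the box of multidegrees by one, so the number of monomials grows
only polynomially with the length. -/
theorem letterSpan_pow_le (hq : q ≠ 0) (n : ℕ) : letterSpan q θ ^ n ≤ normalSpan q θ n := by
  induction n with
  | zero =>
    rw [pow_zero, Submodule.one_le]
    have h : term (gen q θ .α) (gen q θ .γ) (gen q θ .u) (0, 0, 0) 1 = 1 := by
      simp [term, starZPow_zero]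
    rw [← h]
    exact term_mem_termSpan _ _ _ (by simp [mem_degreeBox]) _
  | succ n ih =>
    rw [pow_succ']
    exact (mul_le_mul' le_rfl ih).trans (letterSpan_mul_normalSpan_le hq n)

end filtration

end Pol

/-! ### A mean ergodic estimate -/

section ergodic

theorem tendsto_average_pow {μ : ℂ} (hμ : ‖μ‖ ≤ 1) :
    Tendsto (fun M : ℕ => (M : ℂ)⁻¹ * ∑ n ∈ Finset.range M, μ ^ n) atTop
      (𝓝 (if μ = 1 then 1 else 0)) := by
  split_ifs with h
  · refine tendsto_const_nhds.congr' ?_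
    filter_upwards [eventually_gt_atTop 0] with M hM
    have : (M : ℂ) ≠ 0 := by exact_mod_cast hM.ne'
    simp [h, this]
  · have h0 : Tendsto (fun M : ℕ => (M : ℝ)⁻¹ * (2 / ‖μ - 1‖)) atTop (𝓝 0) := by
      simpa using (tendsto_inv_atTop_nhds_zero_nat (𝕜 := ℝ)).mul_const (2 / ‖μ - 1‖)
    refine squeeze_zero_norm (fun M => ?_) h0
    rw [geom_sum_eq h, norm_mul, norm_inv, Complex.norm_natCast, norm_div]
    gcongr
    calc ‖μ ^ M - 1‖ ≤ ‖μ ^ M‖ + ‖(1 : ℂ)‖ := norm_sub_le _ _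
      _ ≤ 1 + 1 := by
        gcongr
        · rw [norm_pow]; exact pow_le_one₀ (norm_nonneg _) hμ
        · simp
      _ = 2 := by norm_num

/-- Averaging the powers of a contraction projects onto the fixed vectors. -/
theorem norm_sum_filter_le {E ι : Type*} [NormedAddCommGroup E] [NormedSpace ℂ E]
    (T : E →ₗ[ℂ] E) (hT : ∀ x, ‖T x‖ ≤ ‖x‖) (S : Finset ι) (x : ι → E) (μ : ι → ℂ)
    (hμ : ∀ i, ‖μ i‖ ≤ 1) (hx : ∀ i ∈ S, T (x i) = μ i • x i) :
    ‖∑ i ∈ S.filter (fun i => μ i = 1), x i‖ ≤ ‖∑ i ∈ S, x i‖ := by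
  have hpow : ∀ n : ℕ, ∀ i ∈ S, (T ^ n) (x i) = μ i ^ n • x i := by
    intro n i hi
    induction n with
    | zero => simp
    | succ n ih => rw [pow_succ', Module.End.mul_apply, ih, map_smul, hx i hi, smul_smul, pow_succ]
  have hTn : ∀ n : ℕ, ∀ y, ‖(T ^ n) y‖ ≤ ‖y‖ := by
    intro n y
    induction n with
    | zero => simp
    | succ n ih => rw [pow_succ', Module.End.mul_apply]; exact (hT _).trans ih
  set y := ∑ i ∈ S, x i
  have havg : ∀ M : ℕ, ∑ i ∈ S, ((M : ℂ)⁻¹ * ∑ n ∈ Finset.range M, μ i ^ n) • x i =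
      (M : ℂ)⁻¹ • ∑ n ∈ Finset.range M, (T ^ n) y := by
    intro M
    simp only [y, map_sum]
    rw [Finset.sum_comm, Finset.smul_sum]
    refine Finset.sum_congr rfl fun i hi => ?_
    rw [Finset.sum_congr rfl fun n _ => hpow n i hi, ← Finset.sum_smul, smul_smul]
  have hlim : Tendsto (fun M : ℕ => ∑ i ∈ S, ((M : ℂ)⁻¹ * ∑ n ∈ Finset.range M, μ i ^ n) • x i)
      atTop (𝓝 (∑ i ∈ S, (if μ i = 1 then (1 : ℂ) else 0) • x i)) :=
    tendsto_finsetSum _ fun i _ => (tendsto_average_pow (hμ i)).smul_const _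
  have hlim' : ∑ i ∈ S, (if μ i = 1 then (1 : ℂ) else 0) • x i =
      ∑ i ∈ S.filter (fun i => μ i = 1), x i := by
    rw [Finset.sum_filter]
    exact Finset.sum_congr rfl fun i _ => by split_ifs <;> simp
  rw [hlim'] at hlim
  refine le_of_tendsto hlim.norm (Eventually.of_forall fun M => ?_)
  rw [havg, norm_smul, norm_inv, Complex.norm_natCast]
  rcases M.eq_zero_or_pos with rfl | hM
  · simp
  · rw [inv_mul_le_iff₀ (by positivity)]
    refine (norm_sum_le _ _).trans ((Finset.sum_le_sum fun n _ => hTn n y).trans ?_)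
    simp

end ergodic

/-! ### The spectrum of g*g -/

namespace IsTriple

variable {B : Type*} [CStarAlgebra B] {q : ℝ} {c : ℂ} {a g u : B} (H : IsTriple q c a g u)
include H

/-- The spectra of a*a = 1 - h and aa* = 1 - q²h agree away from 0, and z ≠ 1 says exactly that 1 -
z is not the excluded point. -/
theorem div_mem_spectrum (hq : q ≠ 0) {z : ℂ} (hz : z ∈ spectrum ℂ (star g * g)) (hz1 : z ≠ 1) :
    z / (q : ℂ) ^ 2 ∈ spectrum ℂ (star g * g) := by
  have h1 : 1 - z ∈ spectrum ℂ (star a * a) := by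
    rw [H.astar_mul_a]
    exact spectrum.subset_polynomial_aeval _ _ ⟨z, hz, by simp⟩
  have h2 : 1 - z ∈ spectrum ℂ (a * star a) := by
    have : 1 - z ∈ spectrum ℂ (star a * a) \ {0} := ⟨h1, by simpa [sub_eq_zero] using hz1.symm⟩
    rw [spectrum.nonzero_mul_comm] at this
    exact this.1
  rw [H.a_mul_astar, spectrum.map_polynomial_aeval_of_nonempty _ _ ⟨z, hz⟩] at h2
  obtain ⟨w, hw, hwz⟩ := h2
  have hq0 : (q : ℂ) ≠ 0 := by exact_mod_cast hq
  have : z = (q : ℂ) ^ 2 * w := by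
    simp only [eval_sub, eval_one, eval_mul, eval_C, eval_X] at hwz
    linear_combination hwz
  rw [this, mul_div_cancel_left₀ _ (pow_ne_zero 2 hq0)]
  exact hw

theorem mul_mem_spectrum {z : ℂ} (hz : z ∈ spectrum ℂ (star g * g)) (hz1 : (q : ℂ) ^ 2 * z ≠ 1) :
    (q : ℂ) ^ 2 * z ∈ spectrum ℂ (star g * g) := by
  have h1 : 1 - (q : ℂ) ^ 2 * z ∈ spectrum ℂ (a * star a) := by
    rw [H.a_mul_astar]
    exact spectrum.subset_polynomial_aeval _ _ ⟨z, hz, by simp⟩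
  have h2 : 1 - (q : ℂ) ^ 2 * z ∈ spectrum ℂ (star a * a) := by
    have : 1 - (q : ℂ) ^ 2 * z ∈ spectrum ℂ (a * star a) \ {0} :=
      ⟨h1, by simpa [sub_eq_zero] using hz1.symm⟩
    rw [spectrum.nonzero_mul_comm] at this
    exact this.1
  rw [H.astar_mul_a, spectrum.map_polynomial_aeval_of_nonempty _ _ ⟨z, hz⟩] at h2
  obtain ⟨w, hw, hwz⟩ := h2
  have : (q : ℂ) ^ 2 * z = w := by
    simp only [eval_sub, eval_one, eval_X] at hwz
    linear_combination hwz
  rwa [this]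

/-- Any other point could be divided by q² forever without meeting 1, making the spectrum unbounded.
-/
theorem eq_zero_or_eq_pow_of_mem_spectrum (hq : q ≠ 0) (hq1 : |q| < 1) {z : ℂ}
    (hz : z ∈ spectrum ℂ (star g * g)) : z = 0 ∨ ∃ k : ℕ, z = ((q : ℂ) ^ 2) ^ k := by
  by_contra! hcon
  obtain ⟨hz0, hzk⟩ := hcon
  have hq0 : ((q : ℂ) ^ 2) ≠ 0 := pow_ne_zero 2 (by exact_mod_cast hq)
  have hmem : ∀ n : ℕ, z / ((q : ℂ) ^ 2) ^ n ∈ spectrum ℂ (star g * g) := by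
    intro n
    induction n with
    | zero => simpa
    | succ n ih =>
      rw [pow_succ, ← div_div]
      refine H.div_mem_spectrum hq ih ?_
      rw [Ne, div_eq_one_iff_eq (pow_ne_zero n hq0)]
      exact hzk n
  set K := ‖star g * g‖ * ‖(1 : B)‖
  have hle : ∀ n : ℕ, ‖z‖ ≤ K * (q ^ 2) ^ n := by
    intro n
    have := spectrum.norm_le_norm_mul_of_mem (hmem n)
    rw [norm_div, norm_pow, norm_pow, Complex.norm_real, Real.norm_eq_abs, sq_abs,
      div_le_iff₀ (by positivity)] at this
    exact this
  have hlim : Tendsto (fun n : ℕ => K * (q ^ 2) ^ n) atTop (𝓝 0) := by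
    have := (tendsto_pow_atTop_nhds_zero_of_lt_one (sq_nonneg q)
      ((sq_lt_one_iff_abs_lt_one q).2 hq1)).const_mul K
    simpa using this
  exact hz0 (norm_le_zero_iff.1 (ge_of_tendsto' hlim hle))

/-- The norm of h is attained on the spectrum, so g ≠ 0 yields a nonzero point q^(2m). Division by
q² climbs from it to 1, and multiplication by q² then reaches every power. -/
theorem pow_mem_spectrum (hq : q ≠ 0) (hq1 : |q| < 1) (hg : g ≠ 0) (k : ℕ) :
    ((q : ℂ) ^ 2) ^ k ∈ spectrum ℂ (star g * g) := by
  have : Nontrivial B := ⟨g, 0, hg⟩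
  have hq0 : ((q : ℂ) ^ 2) ≠ 0 := pow_ne_zero 2 (by exact_mod_cast hq)
  have hlt : ∀ k : ℕ, ((q : ℂ) ^ 2) ^ (k + 1) ≠ 1 := by
    intro k h
    have h1 : (q ^ 2) ^ (k + 1) = 1 := by exact_mod_cast h
    exact (pow_lt_one₀ (sq_nonneg q) ((sq_lt_one_iff_abs_lt_one q).2 hq1) k.succ_ne_zero).ne h1
  have hsa : IsStarNormal (star g * g) := (IsSelfAdjoint.star_mul_self g).isStarNormal
  obtain ⟨z, hz, hzn⟩ := (IsometricContinuousFunctionalCalculus.isGreatest_norm_spectrum (𝕜 := ℂ) (star g * g)).1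
  have hz0 : z ≠ 0 := by
    rintro rfl
    simp only [norm_zero] at hzn
    rw [CStarRing.norm_star_mul_self] at hzn
    exact hg (by simpa using hzn.symm)
  obtain h | ⟨m, rfl⟩ := H.eq_zero_or_eq_pow_of_mem_spectrum hq hq1 hz
  · exact (hz0 h).elim
  have h1 : (1 : ℂ) ∈ spectrum ℂ (star g * g) := by
    clear hzn hz0
    induction m with
    | zero => simpa using hz
    | succ m ih =>
      refine ih ?_
      have := H.div_mem_spectrum hq hz (hlt m)
      rwa [pow_succ, mul_div_cancel_right₀ _ hq0] at this
  induction k with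
  | zero => simpa using h1
  | succ k ih =>
    rw [pow_succ']
    exact H.mul_mem_spectrum ih (by rw [← pow_succ']; exact hlt k)

/-- No assumption g ≠ 0 is needed: 0 is the limit of the q^(2k), so by continuity the bound also
covers that point. -/
theorem norm_aeval_le (hq : q ≠ 0) (hq1 : |q| < 1) {F : ℂ[X]} {M : ℝ}
    (hF : ∀ k : ℕ, ‖F.eval (((q : ℂ) ^ 2) ^ k)‖ ≤ M) : ‖aeval (star g * g) F‖ ≤ M := by
  have hsa : IsStarNormal (star g * g) := (IsSelfAdjoint.star_mul_self g).isStarNormal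
  have hM : 0 ≤ M := (norm_nonneg _).trans (hF 0)
  rw [← cfc_polynomial F (star g * g)]
  refine norm_cfc_le hM fun z hz => ?_
  obtain rfl | ⟨k, rfl⟩ := H.eq_zero_or_eq_pow_of_mem_spectrum hq hq1 hz
  · have hlim : Tendsto (fun k : ℕ => ((q : ℂ) ^ 2) ^ k) atTop (𝓝 0) := by
      refine tendsto_pow_atTop_nhds_zero_of_norm_lt_one ?_
      rw [norm_pow, Complex.norm_real, Real.norm_eq_abs, sq_abs]
      exact (sq_lt_one_iff_abs_lt_one q).2 hq1
    exact le_of_tendsto ((F.continuous.tendsto 0).comp hlim).norm (Eventually.of_forall hF)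
  · exact hF k

omit H in
theorem exists_bump {r : ℝ} (hr0 : 0 < r) (hr1 : r < 1) (k : ℕ) : ∃ f : ℂ → ℂ, Continuous f ∧
    f 0 = 0 ∧ f ((r : ℂ) ^ k) = 1 ∧ ∀ m, m ≠ k → f ((r : ℂ) ^ m) = 0 := by
  -- This is the distance from r^k to r^(k+1), its nearest neighbour among the other powers and 0; a
  -- tent of this radius vanishes at all of them.
  set δ : ℝ := r ^ k * (1 - r)
  have hδ : 0 < δ := mul_pos (pow_pos hr0 k) (by linarith)
  refine ⟨fun z => ((max 0 (1 - ‖z - (r : ℂ) ^ k‖ / δ) : ℝ) : ℂ), by fun_prop, ?_, by simp, ?_⟩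
  · have h : 1 - ‖(0 : ℂ) - (r : ℂ) ^ k‖ / δ ≤ 0 := by
      rw [zero_sub, norm_neg, norm_pow, Complex.norm_real, Real.norm_of_nonneg hr0.le, sub_nonpos,
        one_le_div hδ]
      exact mul_le_of_le_one_right (pow_pos hr0 k).le (by linarith)
    simp only [max_eq_left h, Complex.ofReal_zero]
  · intro m hm
    have h : 1 - ‖(r : ℂ) ^ m - (r : ℂ) ^ k‖ / δ ≤ 0 := by
      rw [← Complex.ofReal_pow, ← Complex.ofReal_pow, ← Complex.ofReal_sub, Complex.norm_real,
        Real.norm_eq_abs, sub_nonpos, one_le_div hδ]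
      rcases lt_or_gt_of_ne hm with h | h
      · have h1 : r ^ k ≤ r ^ (m + 1) := pow_le_pow_of_le_one hr0.le hr1.le h
        have h2 : r ^ k ≤ r ^ m := pow_le_pow_of_le_one hr0.le hr1.le h.le
        refine le_trans ?_ (le_abs_self _)
        have h3 : r ^ k * (1 - r) ≤ r ^ m * (1 - r) :=
          mul_le_mul_of_nonneg_right h2 (by linarith)
        rw [pow_succ] at h1
        simp only [δ]
        linarith
      · have h1 : r ^ m ≤ r ^ (k + 1) := pow_le_pow_of_le_one hr0.le hr1.le h
        refine le_trans ?_ (neg_le_abs _)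
        rw [pow_succ] at h1
        simp only [δ]
        linarith
    simp only [max_eq_left h, Complex.ofReal_zero]

/-- The spectral projection of `g*g` for the eigenvalue `q^(2k)`. -/
theorem exists_projection (hq : q ≠ 0) (hq1 : |q| < 1) (hg : g ≠ 0) (k : ℕ) :
    ∃ e : B, e ≠ 0 ∧ e * e = e ∧ star e = e ∧ star g * g * e = ((q : ℂ) ^ 2) ^ k • e ∧
      ∀ x, Commute (star g * g) x → Commute e x := by
  have hsa : IsSelfAdjoint (star g * g) := IsSelfAdjoint.star_mul_self g
  have hn : IsStarNormal (star g * g) := hsa.isStarNormal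
  have hcast : (q : ℂ) ^ 2 = ((q ^ 2 : ℝ) : ℂ) := by push_cast; rfl
  obtain ⟨f, hf, hf0, hf1, hfm⟩ := exists_bump (r := q ^ 2) (by positivity)
    ((sq_lt_one_iff_abs_lt_one q).2 hq1) k
  rw [← hcast] at hf1 hfm
  -- On the spectrum f is the indicator of the isolated point q^(2k); each property of the
  -- projection is then a pointwise identity.
  have hval : ∀ z ∈ spectrum ℂ (star g * g),
      (z = ((q : ℂ) ^ 2) ^ k ∧ f z = 1) ∨ f z = 0 := by
    intro z hz
    obtain rfl | ⟨m, rfl⟩ := H.eq_zero_or_eq_pow_of_mem_spectrum hq hq1 hz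
    · exact Or.inr hf0
    · by_cases h : m = k
      · subst h; exact Or.inl ⟨rfl, hf1⟩
      · exact Or.inr (hfm m h)
  have hfc : ContinuousOn f (spectrum ℂ (star g * g)) := hf.continuousOn
  refine ⟨cfc f (star g * g), ?_, ?_, ?_, ?_, fun x hx => ?_⟩
  · intro h0
    have := norm_apply_le_norm_cfc f (star g * g) (H.pow_mem_spectrum hq hq1 hg k)
    rw [hf1, h0] at this
    norm_num at this
  · rw [← cfc_mul f f (star g * g)]
    refine cfc_congr fun z hz => ?_
    rcases hval z hz with ⟨_, h⟩ | h <;> simp [h]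
  · rw [← cfc_star]
    refine cfc_congr fun z hz => ?_
    rcases hval z hz with ⟨_, h⟩ | h <;> simp [h]
  · nth_rw 1 [← cfc_id ℂ (star g * g)]
    rw [← cfc_mul id f (star g * g), ← cfc_smul (((q : ℂ) ^ 2) ^ k) f (star g * g)]
    refine cfc_congr fun z hz => ?_
    rcases hval z hz with ⟨h', h⟩ | h
    · simp [h', hf1]
    · simp [h]
  · exact hx.cfc (by rwa [hsa.star_eq]) f

end IsTriple

/-! ### Isolating one monomial in a representation -/

namespace QComm

variable {A : Type*} [Ring A] [StarRing A] [Algebra ℂ A] [StarModule ℂ A] {s : ℂ} {x y : A}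

theorem star_right (h : QComm s (star x) y) (hs : s ≠ 0) : QComm (star s)⁻¹ x (star y) := by
  have := h.star_star.symm (by simpa using hs)
  rwa [_root_.star_star] at this

end QComm

theorem aeval_mul_of_mul_eq_smul {A : Type*} [Ring A] [Algebra ℂ A] {h e : A} {z : ℂ}
    (he : h * e = z • e) (F : ℂ[X]) : aeval h F * e = F.eval z • e := by
  induction F using Polynomial.induction_on' with
  | add p r hp hr => rw [map_add, add_mul, hp, hr, eval_add, add_smul]
  | monomial n t =>
    have hn : ∀ n : ℕ, h ^ n * e = z ^ n • e := by
      intro n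
      induction n with
      | zero => simp
      | succ n ih => rw [pow_succ, mul_assoc, he, mul_smul_comm, ih, smul_smul, pow_succ']
    rw [aeval_monomial, eval_monomial, mul_assoc, hn, ← Algebra.smul_def, smul_smul]

namespace IsTriple

variable {B : Type*} [CStarAlgebra B] {q : ℝ} {c : ℂ} {a g u : B}

/-- Compressing to an eigenspace of `g*g` and averaging over `u` and `g` isolates one monomial. -/
theorem norm_term_mul_projection_le (H : IsTriple q c a g u) (hq : q ≠ 0) (hq1 : |q| < 1)
    (hc : ‖c‖ = 1) (hcn : ∀ n : ℤ, n ≠ 0 → c ^ n ≠ 1) (S : Finset (ℤ × ℤ × ℤ))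
    (f : ℤ × ℤ × ℤ → ℂ[X]) {χ₀ : ℤ × ℤ × ℤ} (hχ₀ : χ₀ ∈ S) {k : ℕ} {e : B} (hee : e * e = e)
    (hes : star e = e) (hhe : star g * g * e = ((q : ℂ) ^ 2) ^ k • e)
    (hcomm : ∀ x, Commute (star g * g) x → Commute e x) (hne : ‖e‖ = 1) :
    ‖term a g u χ₀ (f χ₀) * e‖ ≤ ‖∑ χ ∈ S, term a g u χ (f χ)‖ := by
  have hc0 : c ≠ 0 := by rintro rfl; simp at hc
  have hq0 : (q : ℂ) ≠ 0 := by exact_mod_cast hq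
  have hcstar : star c = c⁻¹ := (Complex.inv_eq_conj hc).symm
  have hqstar : star (q : ℂ) = q := Complex.conj_ofReal q
  set t : ℤ × ℤ × ℤ → B := fun χ => term a g u χ (f χ) with ht
  set r : ℂ := ((q : ℂ) ^ 2) ^ k with hr
  have hr0 : r ≠ 0 := pow_ne_zero _ (pow_ne_zero _ hq0)
  have heh : e * (star g * g) = r • e := by rw [(hcomm _ (Commute.refl _)).eq, hhe]
  have heg := (hcomm _ H.h_commute_g).eq
  have hegs := (hcomm _ H.h_commute_gstar).eq
  have heu := (hcomm _ (H.h_commute_u hc)).eq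
  have heus := (hcomm _ (H.h_commute_ustar hc)).eq
  -- Multiplying by the adjoint of the target monomial gives it relative degree zero, so both
  -- averagings fix it and x χ₀ = (t χ₀ e)*(t χ₀ e).
  set d : ℤ × ℤ × ℤ → B := fun χ => star (t χ₀) * t χ with hd
  set x : ℤ × ℤ × ℤ → B := fun χ => e * d χ * e with hx
  -- commutation relations
  have hud : ∀ χ, QComm (c⁻¹ ^ (χ.2.1 - χ₀.2.1)) u (d χ) := by
    intro χ
    have h1 : QComm (c⁻¹ ^ (-χ₀.2.1)) u (star (t χ₀)) := by
      have h2 := H.u_qcomm_term hc χ₀ (f χ₀)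
      have h3 : QComm (c ^ χ₀.2.1) (star u) (t χ₀) := by
        unfold QComm at h2 ⊢
        have h4 : t χ₀ * u = c ^ χ₀.2.1 • (u * t χ₀) := by
          rw [h2, smul_smul, ← mul_zpow, mul_inv_cancel₀ hc0, one_zpow, one_smul]
        calc star u * t χ₀ = star u * (t χ₀ * u) * star u := by
              rw [mul_assoc, mul_assoc, H.coisometry, mul_one]
          _ = _ := by
              rw [h4, mul_smul_comm, ← mul_assoc, H.isometry, one_mul, smul_mul_assoc]
      have h4 := h3.star_right (zpow_ne_zero _ hc0)
      convert h4 using 1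
      rw [star_zpow₀, hcstar, zpow_neg]
    have := h1.mul_right (H.u_qcomm_term hc χ (f χ))
    rwa [← zpow_add₀ (inv_ne_zero hc0), neg_add_eq_sub] at this
  have hgd : ∀ χ, QComm ((q : ℂ)⁻¹ ^ (χ.1 - χ₀.1) * c ^ (χ.2.2 - χ₀.2.2)) g (d χ) := by
    intro χ
    have h1 := (H.gstar_qcomm_term hq hc χ₀ (f χ₀)).star_right
      (mul_ne_zero (zpow_ne_zero _ (inv_ne_zero hq0)) (zpow_ne_zero _ (inv_ne_zero hc0)))
    have := h1.mul_right (H.g_qcomm_term hq hc χ (f χ))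
    convert this using 1
    rw [star_mul, star_zpow₀, star_zpow₀, star_inv₀, star_inv₀, hcstar, hqstar, inv_inv,
      zpow_sub₀ (inv_ne_zero hq0), zpow_sub₀ hc0, mul_inv]
    field_simp
  have hgsd : ∀ χ, QComm ((q : ℂ)⁻¹ ^ (χ.1 - χ₀.1) * c⁻¹ ^ (χ.2.2 - χ₀.2.2)) (star g) (d χ) := by
    intro χ
    have h1 := (show QComm _ (star (star g)) (t χ₀) from by
      rw [star_star]; exact H.g_qcomm_term hq hc χ₀ (f χ₀)).star_right
      (mul_ne_zero (zpow_ne_zero _ (inv_ne_zero hq0)) (zpow_ne_zero _ hc0))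
    have := h1.mul_right (H.gstar_qcomm_term hq hc χ (f χ))
    convert this using 1
    rw [star_mul, star_zpow₀, star_zpow₀, star_inv₀, hcstar, hqstar,
      zpow_sub₀ (inv_ne_zero hq0), zpow_sub₀ (inv_ne_zero hc0), mul_inv]
    field_simp
  -- the off-diagonal part vanishes
  have hxj : ∀ χ : ℤ × ℤ × ℤ, χ.1 ≠ χ₀.1 → x χ = 0 := by
    intro χ hχ
    have h1 := (hgsd χ).mul_left (hgd χ)
    set s := (q : ℂ)⁻¹ ^ (χ.1 - χ₀.1) * c⁻¹ ^ (χ.2.2 - χ₀.2.2) *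
      ((q : ℂ)⁻¹ ^ (χ.1 - χ₀.1) * c ^ (χ.2.2 - χ₀.2.2)) with hs
    have hs1 : s ≠ 1 := by
      have hs2 : s = (q : ℂ)⁻¹ ^ (χ.1 - χ₀.1) * (q : ℂ)⁻¹ ^ (χ.1 - χ₀.1) := by
        have : c⁻¹ ^ (χ.2.2 - χ₀.2.2) * c ^ (χ.2.2 - χ₀.2.2) = 1 := by
          rw [← mul_zpow, inv_mul_cancel₀ hc0, one_zpow]
        rw [hs]
        linear_combination ((q : ℂ)⁻¹ ^ (χ.1 - χ₀.1) * (q : ℂ)⁻¹ ^ (χ.1 - χ₀.1)) * this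
      intro h
      have h3 := congrArg norm h
      rw [hs2, norm_mul, norm_zpow, norm_inv, Complex.norm_real, Real.norm_eq_abs, norm_one,
        ← zpow_add₀ (inv_ne_zero (abs_ne_zero.2 hq)), inv_zpow, inv_eq_one] at h3
      rw [zpow_eq_one_iff_right₀ (abs_nonneg q) hq1.ne] at h3
      omega
    -- h acts on e as the scalar r from either side, while moving it across d χ costs s, a
    -- nontrivial power of q⁻².
    have h2 : r • x χ = s • (r • x χ) := by
      calc r • x χ = e * (star g * g) * d χ * e := by
            rw [heh, smul_mul_assoc, smul_mul_assoc]
        _ = e * (star g * g * d χ) * e := by simp only [mul_assoc]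
        _ = s • (e * d χ * (star g * g * e)) := by
            rw [h1]; simp only [mul_assoc, mul_smul_comm, smul_mul_assoc]
        _ = _ := by rw [hhe, mul_smul_comm]
    have h3 : (1 - s) • (r • x χ) = 0 := by rw [sub_smul, one_smul, ← h2, sub_self]
    rcases smul_eq_zero.1 h3 with h4 | h4
    · exact (hs1 (sub_eq_zero.1 h4).symm).elim
    · exact (smul_eq_zero.1 h4).resolve_left hr0
  -- averaging over `u`
  have hnu : ‖u‖ ≤ 1 := by
    have h1 : ‖u‖ * ‖u‖ = ‖(1 : B)‖ := by rw [← CStarRing.norm_star_mul_self, H.isometry]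
    have : Nontrivial B := ⟨e, 0, by rintro rfl; simp at hne⟩
    rw [CStarRing.norm_one] at h1
    nlinarith [norm_nonneg u]
  have step1 : ‖∑ χ ∈ S.filter (fun χ => c⁻¹ ^ (χ.2.1 - χ₀.2.1) = 1), x χ‖ ≤ ‖∑ χ ∈ S, x χ‖ := by
    refine norm_sum_filter_le
      ((LinearMap.mulLeft ℂ u).comp (LinearMap.mulRight ℂ (star u))) (fun y => ?_) S x
      (fun χ => c⁻¹ ^ (χ.2.1 - χ₀.2.1)) (fun χ => ?_) (fun χ _ => ?_)
    · simp only [LinearMap.comp_apply, LinearMap.mulLeft_apply, LinearMap.mulRight_apply]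
      calc ‖u * (y * star u)‖ ≤ ‖u‖ * (‖y‖ * ‖star u‖) :=
            (norm_mul_le _ _).trans (by gcongr; exact norm_mul_le _ _)
        _ ≤ 1 * (‖y‖ * 1) := by rw [norm_star]; gcongr
        _ = ‖y‖ := by ring
    · rw [norm_zpow, norm_inv, hc, inv_one, one_zpow]
    · simp only [LinearMap.comp_apply, LinearMap.mulLeft_apply, LinearMap.mulRight_apply, hx]
      calc u * (e * d χ * e * star u) = u * e * d χ * (e * star u) := by simp only [mul_assoc]
        _ = e * (u * d χ) * star u * e := by rw [← heu, heus]; simp only [mul_assoc]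
        _ = c⁻¹ ^ (χ.2.1 - χ₀.2.1) • (e * d χ * (u * star u) * e) := by
            rw [hud χ]; simp only [mul_assoc, mul_smul_comm, smul_mul_assoc]
        _ = _ := by rw [H.coisometry, mul_one]
  -- averaging over `g`
  have hnr : 0 < ‖r‖ := norm_pos_iff.2 hr0
  have hnge : ‖g * e‖ * ‖g * e‖ = ‖r‖ := by
    rw [← CStarRing.norm_star_mul_self, star_mul, hes, mul_assoc, ← mul_assoc (star g), hhe,
      mul_smul_comm, hee, norm_smul, hne, mul_one]
  set S₁ := S.filter (fun χ => c⁻¹ ^ (χ.2.1 - χ₀.2.1) = 1)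
  have step2 : ‖∑ χ ∈ S₁.filter (fun χ => c⁻¹ ^ (χ.2.2 - χ₀.2.2) = 1), x χ‖ ≤
      ‖∑ χ ∈ S₁, x χ‖ := by
    -- As (ge)*(ge) = r e, compressing by g e and dividing by r is a contraction. It scales each x χ
    -- of the right a-degree by a phase; the remaining x χ are already zero.
    refine norm_sum_filter_le
      (r⁻¹ • (LinearMap.mulLeft ℂ (star (g * e))).comp (LinearMap.mulRight ℂ (g * e)))
      (fun y => ?_) S₁ x (fun χ => c⁻¹ ^ (χ.2.2 - χ₀.2.2)) (fun χ => ?_) (fun χ _ => ?_)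
    · simp only [LinearMap.smul_apply, LinearMap.comp_apply, LinearMap.mulLeft_apply,
        LinearMap.mulRight_apply]
      calc ‖r⁻¹ • (star (g * e) * (y * (g * e)))‖
          ≤ ‖r‖⁻¹ * (‖g * e‖ * (‖y‖ * ‖g * e‖)) := by
            rw [norm_smul, norm_inv]
            gcongr
            refine (norm_mul_le _ _).trans ?_
            rw [norm_star]
            gcongr
            exact norm_mul_le _ _
        _ = ‖r‖⁻¹ * ((‖g * e‖ * ‖g * e‖) * ‖y‖) := by ring
        _ = ‖y‖ := by rw [hnge, inv_mul_cancel_left₀ hnr.ne']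
    · rw [norm_zpow, norm_inv, hc, inv_one, one_zpow]
    · by_cases hj : χ.1 = χ₀.1
      · simp only [LinearMap.smul_apply, LinearMap.comp_apply, LinearMap.mulLeft_apply,
          LinearMap.mulRight_apply, hx]
        have h1 := hgsd χ
        rw [hj, sub_self, zpow_zero, one_mul] at h1
        rw [inv_smul_eq_iff₀ hr0]
        calc star (g * e) * (e * d χ * e * (g * e))
            = e * (star g * e) * d χ * (e * g) * e := by
              rw [star_mul, hes]; simp only [mul_assoc]
          _ = (e * e) * (star g * d χ) * (g * (e * e)) := by
              rw [← hegs, heg]; simp only [mul_assoc]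
          _ = c⁻¹ ^ (χ.2.2 - χ₀.2.2) • (e * d χ * (star g * g * e)) := by
              rw [h1, hee]; simp only [mul_assoc, mul_smul_comm, smul_mul_assoc]
          _ = _ := by rw [hhe, mul_smul_comm, smul_comm]
      · rw [hxj χ hj, map_zero, smul_zero]
  -- Because c is not a root of unity, surviving both averagings means having exactly the degrees of
  -- χ₀.
  have hone : ∀ n : ℤ, c⁻¹ ^ n = 1 ↔ n = 0 := by
    intro n
    rw [inv_zpow, inv_eq_one]
    exact ⟨fun h => by_contra fun h' => hcn n h' h, fun h => by rw [h, zpow_zero]⟩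
  have hsum : ∑ χ ∈ S₁.filter (fun χ => c⁻¹ ^ (χ.2.2 - χ₀.2.2) = 1), x χ = x χ₀ := by
    refine Finset.sum_eq_single χ₀ (fun χ hχ hne => ?_) (fun h => ?_)
    · refine hxj χ fun hj => hne ?_
      simp only [S₁, Finset.mem_filter, hone] at hχ
      exact Prod.ext hj (Prod.ext (by omega) (by omega))
    · simp [S₁, hχ₀] at h
  have hmain : ‖x χ₀‖ ≤ ‖t χ₀ * e‖ * ‖∑ χ ∈ S, t χ‖ := by
    rw [← hsum]
    refine step2.trans (step1.trans ?_)
    have h1 : ∑ χ ∈ S, x χ = star (t χ₀ * e) * (∑ χ ∈ S, t χ) * e := by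
      simp only [hx, hd, star_mul, hes, Finset.mul_sum, Finset.sum_mul, mul_assoc]
    rw [h1]
    calc _ ≤ ‖star (t χ₀ * e)‖ * ‖∑ χ ∈ S, t χ‖ * ‖e‖ :=
          (norm_mul_le _ _).trans (by gcongr; exact norm_mul_le _ _)
      _ = _ := by rw [hne, mul_one, norm_star]
  have hx0 : ‖x χ₀‖ = ‖t χ₀ * e‖ * ‖t χ₀ * e‖ := by
    rw [← CStarRing.norm_star_mul_self]
    simp only [hx, hd, star_mul, hes, mul_assoc]
  rw [hx0] at hmain
  rcases (norm_nonneg (t χ₀ * e)).eq_or_lt with h0 | h0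
  · rw [← h0]; exact norm_nonneg _
  · exact le_of_mul_le_mul_left hmain h0

/-- On the eigenspace (t e)*(t e) = e F(h) e = F(q^(2k)) e, so the scalar F(q^(2k)) has modulus ‖t
e‖², which the compression estimate controls. -/
theorem norm_eval_le (H : IsTriple q c a g u) (hq : q ≠ 0) (hq1 : |q| < 1)
    (hc : ‖c‖ = 1) (hcn : ∀ n : ℤ, n ≠ 0 → c ^ n ≠ 1) (hg : g ≠ 0) (S : Finset (ℤ × ℤ × ℤ))
    (f : ℤ × ℤ × ℤ → ℂ[X]) {χ₀ : ℤ × ℤ × ℤ} (hχ₀ : χ₀ ∈ S) {F : ℂ[X]}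
    (hF : star (term a g u χ₀ (f χ₀)) * term a g u χ₀ (f χ₀) = aeval (star g * g) F) (k : ℕ) :
    ‖F.eval (((q : ℂ) ^ 2) ^ k)‖ ≤ ‖∑ χ ∈ S, term a g u χ (f χ)‖ ^ 2 := by
  obtain ⟨e, he0, hee, hes, hhe, hcomm⟩ := H.exists_projection hq hq1 hg k
  have hne : ‖e‖ = 1 := by
    have h1 := CStarRing.norm_star_mul_self (x := e)
    rw [hes, hee] at h1
    exact (mul_eq_left₀ (norm_ne_zero_iff.2 he0)).1 h1.symm
  have h1 := H.norm_term_mul_projection_le hq hq1 hc hcn S f hχ₀ hee hes hhe hcomm hne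
  have h2 : ‖F.eval (((q : ℂ) ^ 2) ^ k)‖ = ‖term a g u χ₀ (f χ₀) * e‖ ^ 2 := by
    rw [sq ‖_‖, ← CStarRing.norm_star_mul_self, star_mul, hes, mul_assoc, ← mul_assoc (star _), hF,
      aeval_mul_of_mul_eq_smul hhe, mul_smul_comm, hee, norm_smul, hne, mul_one]
  rw [h2]
  gcongr

end IsTriple

/-- If t < s, then N³ (t/s)^N tends to 0 along N = 2^n, contradicting a lower bound by a positive
constant. -/
theorem le_of_pow_two_pow_le {s t : ℝ} (hs : 0 ≤ s) (ht : 0 ≤ t) {m : ℕ}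
    (h : ∀ n : ℕ, s ^ 2 ^ n ≤ ((2 * (m * 2 ^ n) + 1) ^ 3 : ℕ) * t ^ 2 ^ n) : s ≤ t := by
  by_contra! hlt
  have hs0 : 0 < s := ht.trans_lt hlt
  have hρ0 : 0 ≤ t / s := div_nonneg ht hs
  have hlim : Tendsto (fun N : ℕ => (2 * (m : ℝ) + 1) ^ 3 * ((N : ℝ) ^ 3 * (t / s) ^ N)) atTop
      (𝓝 0) := by
    simpa using (tendsto_pow_const_mul_const_pow_of_abs_lt_one 3 (r := t / s)
      (by rw [abs_of_nonneg hρ0, div_lt_one hs0]; exact hlt)).const_mul ((2 * (m : ℝ) + 1) ^ 3)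
  have hlim2 := hlim.comp (tendsto_pow_atTop_atTop_of_one_lt (r := 2) one_lt_two)
  have hge : ∀ n : ℕ, (1 : ℝ) ≤
      (2 * (m : ℝ) + 1) ^ 3 * (((2 ^ n : ℕ) : ℝ) ^ 3 * (t / s) ^ (2 ^ n)) := by
    intro n
    have h1 := h n
    have hN : (1 : ℝ) ≤ ((2 ^ n : ℕ) : ℝ) := by exact_mod_cast Nat.one_le_two_pow
    set N : ℕ := 2 ^ n
    rw [div_pow, ← mul_assoc, ← mul_pow, ← mul_div_assoc, le_div_iff₀ (pow_pos hs0 N), one_mul]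
    refine h1.trans ?_
    gcongr
    push_cast
    gcongr
    nlinarith [(Nat.cast_nonneg m : (0 : ℝ) ≤ m)]
  exact absurd (ge_of_tendsto' hlim2 hge) (by norm_num)

/-! ### Comparison of two representations -/

namespace Pol

variable {q θ : ℝ} {B₁ B₂ : Type*} [CStarAlgebra B₁] [CStarAlgebra B₂]

/-- The polynomial F is computed in `Pol q θ`, hence is shared by φ₁ and φ₂. The first
representation bounds its values at all q^(2k), and these values bound the norm in the second, which
may kill γ. -/
theorem norm_term_le (hq : q ≠ 0) (hq1 : |q| < 1) (hθ : Irrational θ) (φ₁ : Pol q θ →⋆ₐ[ℂ] B₁)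
    (φ₂ : Pol q θ →⋆ₐ[ℂ] B₂) (hφ : φ₁ (gen q θ .γ) ≠ 0) (S : Finset (ℤ × ℤ × ℤ))
    (f : ℤ × ℤ × ℤ → ℂ[X]) {χ : ℤ × ℤ × ℤ} (hχ : χ ∈ S) :
    ‖φ₂ (term (gen q θ .α) (gen q θ .γ) (gen q θ .u) χ (f χ))‖ ≤
      ‖φ₁ (∑ χ ∈ S, term (gen q θ .α) (gen q θ .γ) (gen q θ .u) χ (f χ))‖ := by
  have H := isTriple_gen (q := q) (θ := θ)
  have hc := norm_phase θ
  obtain ⟨P, -, hP⟩ := H.exists_star_term_mul_term χ hq hc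
  have hF₁ := congrArg φ₁ (hP (f χ))
  have hF₂ := congrArg φ₂ (hP (f χ))
  rw [map_aeval_star_mul, map_mul, map_star] at hF₁ hF₂
  rw [map_term] at hF₁
  refine le_of_sq_le_sq ?_ (norm_nonneg _)
  rw [sq ‖φ₂ _‖, ← CStarRing.norm_star_mul_self, hF₂]
  refine (H.map φ₂).norm_aeval_le hq hq1 fun k => ?_
  refine ((H.map φ₁).norm_eval_le hq hq1 hc (fun n hn => phase_zpow_ne_one hθ hn) hφ S f hχ hF₁
    k).trans_eq ?_
  simp only [map_sum, map_term]

theorem norm_le_mul_of_mem (hq : q ≠ 0) (hq1 : |q| < 1) (hθ : Irrational θ)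
    (φ₁ : Pol q θ →⋆ₐ[ℂ] B₁) (φ₂ : Pol q θ →⋆ₐ[ℂ] B₂) (hφ : φ₁ (gen q θ .γ) ≠ 0) {n : ℕ}
    {x : Pol q θ} (hx : x ∈ letterSpan q θ ^ n) :
    ‖φ₂ x‖ ≤ ((2 * n + 1) ^ 3 : ℕ) * ‖φ₁ x‖ := by
  obtain ⟨f, rfl⟩ := exists_sum_of_mem_termSpan _ _ _ (letterSpan_pow_le hq n hx)
  conv_lhs => rw [map_sum]
  refine (norm_sum_le_of_le _ fun χ hχ => norm_term_le hq hq1 hθ φ₁ φ₂ hφ _ f hχ).trans_eq ?_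
  rw [Finset.sum_const, card_degreeBox, nsmul_eq_mul]

/-- A representation that does not kill `γ` dominates every other representation. -/
theorem norm_le_norm (hq : q ≠ 0) (hq1 : |q| < 1) (hθ : Irrational θ)
    (φ₁ : Pol q θ →⋆ₐ[ℂ] B₁) (φ₂ : Pol q θ →⋆ₐ[ℂ] B₂) (hφ : φ₁ (gen q θ .γ) ≠ 0)
    (x : Pol q θ) : ‖φ₂ x‖ ≤ ‖φ₁ x‖ := by
  obtain ⟨m, hm⟩ := exists_mem_letterSpan_pow (star x * x)
  have hsa : IsSelfAdjoint (star x * x) := IsSelfAdjoint.star_mul_self x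
  -- For self-adjoint y the norm of y^(2^n) is ‖y‖^(2^n), whereas its length is at most m · 2^n; the
  -- comparison constant grows only polynomially in 2^n.
  have hb : ‖φ₂ (star x * x)‖ ≤ ‖φ₁ (star x * x)‖ := by
    refine le_of_pow_two_pow_le (norm_nonneg _) (norm_nonneg _) (m := m) fun n => ?_
    rw [← (hsa.map φ₁).norm_pow_two_pow n, ← (hsa.map φ₂).norm_pow_two_pow n, ← map_pow, ← map_pow]
    refine norm_le_mul_of_mem hq hq1 hθ φ₁ φ₂ hφ ?_
    rw [pow_mul]
    exact Submodule.pow_mem_pow _ hm _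
  rw [map_mul, map_mul, map_star, map_star, CStarRing.norm_star_mul_self,
    CStarRing.norm_star_mul_self, ← sq, ← sq] at hb
  exact le_of_sq_le_sq hb (norm_nonneg _)

/-- If φ x = 0, every monomial of x has F vanishing at the infinitely many points q^(2k). So F = f̄
f P is zero, and P ≠ 0 forces f = 0. -/
theorem injective_of_map_gen_ne_zero (hq : q ≠ 0) (hq1 : |q| < 1) (hθ : Irrational θ)
    (φ : Pol q θ →⋆ₐ[ℂ] B₁) (hφ : φ (gen q θ .γ) ≠ 0) : Function.Injective φ := by
  rw [injective_iff_map_eq_zero]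
  intro x hx
  obtain ⟨n, hn⟩ := exists_mem_letterSpan_pow x
  obtain ⟨f, rfl⟩ := exists_sum_of_mem_termSpan _ _ _ (letterSpan_pow_le hq n hn)
  refine Finset.sum_eq_zero fun χ hχ => ?_
  have H := isTriple_gen (q := q) (θ := θ)
  have hc := norm_phase θ
  obtain ⟨P, hP0, hP⟩ := H.exists_star_term_mul_term χ hq hc
  have hF := congrArg φ (hP (f χ))
  rw [map_aeval_star_mul, map_mul, map_star, map_term] at hF
  have heval : ∀ k : ℕ, ((f χ).map (starRingEnd ℂ) * f χ * P).eval (((q : ℂ) ^ 2) ^ k) = 0 := by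
    intro k
    have h1 := (H.map φ).norm_eval_le hq hq1 hc (fun n hn => phase_zpow_ne_one hθ hn) hφ _ f hχ hF k
    simp only [← map_term, ← map_sum, hx, norm_zero] at h1
    exact norm_le_zero_iff.1 (h1.trans_eq (by norm_num))
  have hinj : Function.Injective fun k : ℕ => ((q : ℂ) ^ 2) ^ k := by
    intro k l hkl
    simp only at hkl
    have h1 : (q ^ 2) ^ k = (q ^ 2) ^ l := by exact_mod_cast hkl
    exact pow_right_injective₀ (by positivity) ((sq_lt_one_iff_abs_lt_one q).2 hq1).ne h1
  have hzero := Polynomial.eq_zero_of_infinite_isRoot _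
    ((Set.infinite_range_of_injective hinj).mono (by rintro _ ⟨k, rfl⟩; exact heval k))
  have hf : f χ = 0 := by
    rcases mul_eq_zero.1 hzero with h | h
    · rcases mul_eq_zero.1 h with h | h
      · exact (Polynomial.map_eq_zero _).1 h
      · exact h
    · exact (hP0 h).elim
  rw [hf, term_zero]

end Pol

/-! ### A concrete representation on ℓ²(ℕ × ℤ) -/

section representation

open scoped ENNReal

variable {ι : Type*}

/-- The Hilbert space of square summable families. -/
abbrev SqSum (ι : Type*) : Type _ := lp (fun _ : ι => ℂ) 2

theorem SqSum.summable (f : SqSum ι) : Summable fun i => ‖f i‖ ^ 2 := by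
  simpa using (memℓp_gen_iff (by simp)).1 (lp.memℓp f)

theorem SqSum.norm_sq (f : SqSum ι) : ‖f‖ ^ 2 = ∑' i, ‖f i‖ ^ 2 := by
  simpa using lp.norm_rpow_eq_tsum (p := 2) (by simp) f

/-- A weighted composition operator. -/
def weightedComp (w : ι → ℂ) (σ : ι → ι) (hw : ∀ i, ‖w i‖ ≤ 1) (hσ : Function.Injective σ) :
    SqSum ι →L[ℂ] SqSum ι :=
  have hle : ∀ (f : SqSum ι) i, ‖w i * f (σ i)‖ ^ 2 ≤ ‖f (σ i)‖ ^ 2 := fun f i => by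
    rw [norm_mul]
    gcongr
    exact mul_le_of_le_one_left (norm_nonneg _) (hw i)
  have hs : ∀ f : SqSum ι, Summable fun i => ‖w i * f (σ i)‖ ^ 2 := fun f =>
    Summable.of_nonneg_of_le (fun i => by positivity) (hle f) (f.summable.comp_injective hσ)
  LinearMap.mkContinuous
    { toFun := fun f => ⟨fun i => w i * f (σ i), (memℓp_gen_iff (by simp)).2 (by simpa using hs f)⟩
      map_add' := fun f g => by ext i; exact mul_add _ _ _
      map_smul' := fun t f => by ext i; simp; ring }
    1 fun f => by
      rw [one_mul]
      refine le_of_sq_le_sq ?_ (norm_nonneg _)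
      rw [SqSum.norm_sq, SqSum.norm_sq]
      refine ((hs f).tsum_le_tsum (hle f) (f.summable.comp_injective hσ)).trans ?_
      exact tsum_comp_le_tsum_of_inj f.summable (fun i => by positivity) hσ

variable {w : ι → ℂ} {σ : ι → ι} {hw : ∀ i, ‖w i‖ ≤ 1} {hσ : Function.Injective σ}

theorem weightedComp_apply (f : SqSum ι) (i : ι) :
    weightedComp w σ hw hσ f i = w i * f (σ i) := rfl

theorem star_weightedComp_apply [DecidableEq ι] (f : SqSum ι) (i : ι) :
    star (weightedComp w σ hw hσ) f (σ i) = star (w i) * f i := by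
  have h1 : weightedComp w σ hw hσ (lp.single 2 (σ i) 1) = lp.single 2 i (w i) := by
    ext j
    rw [weightedComp_apply]
    by_cases h : j = i
    · subst h; simp
    · simp [lp.single_apply, h, hσ.eq_iff]
  have h2 := ContinuousLinearMap.adjoint_inner_right (weightedComp w σ hw hσ)
    (lp.single 2 (σ i) 1) f
  rw [h1, lp.inner_single_left, lp.inner_single_left] at h2
  simpa [ContinuousLinearMap.star_eq_adjoint, mul_comm] using h2

theorem star_weightedComp_apply_of_notMem [DecidableEq ι] (f : SqSum ι) {k : ι}
    (hk : k ∉ Set.range σ) : star (weightedComp w σ hw hσ) f k = 0 := by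
  have h1 : weightedComp w σ hw hσ (lp.single 2 k 1) = 0 := by
    ext j
    rw [weightedComp_apply]
    have : σ j ≠ k := fun h => hk ⟨j, h⟩
    simp [lp.single_apply, this]
  have h2 := ContinuousLinearMap.adjoint_inner_right (weightedComp w σ hw hσ)
    (lp.single 2 k 1) f
  rw [h1, inner_zero_left, lp.inner_single_left] at h2
  simpa [ContinuousLinearMap.star_eq_adjoint] using h2

/-- On the basis indexed by (n, m), a is a weighted backward shift in n, g is diagonal with entries
qⁿ c⁻ᵐ, and u is a bilateral shift in m. The factor c⁻ᵐ is what gives u*gu = c g. -/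
theorem exists_isTriple {q : ℝ} (hq1 : |q| < 1) {c : ℂ} (hc : ‖c‖ = 1) :
    ∃ a g u : SqSum (ℕ × ℤ) →L[ℂ] SqSum (ℕ × ℤ), IsTriple q c a g u ∧ g ≠ 0 := by
  have hc0 : c ≠ 0 := by rintro rfl; simp at hc
  have hq2 : ∀ n : ℕ, 0 ≤ 1 - q ^ (2 * n) := fun n => by
    rw [pow_mul, sub_nonneg]
    exact pow_le_one₀ (sq_nonneg q) ((sq_lt_one_iff_abs_lt_one q).2 hq1).le
  set wa : ℕ × ℤ → ℂ := fun i => (√(1 - q ^ (2 * (i.1 + 1))) : ℝ) with hwa_def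
  set wg : ℕ × ℤ → ℂ := fun i => (q : ℂ) ^ i.1 * c⁻¹ ^ i.2 with hwg_def
  have hwa : ∀ i, ‖wa i‖ ≤ 1 := fun i => by
    rw [Complex.norm_real, Real.norm_of_nonneg (Real.sqrt_nonneg _), Real.sqrt_le_one, pow_mul]
    linarith [pow_nonneg (sq_nonneg q) (i.1 + 1)]
  have hwg : ∀ i, ‖wg i‖ ≤ 1 := fun i => by
    rw [norm_mul, norm_zpow, norm_inv, hc, inv_one, one_zpow, mul_one, norm_pow, Complex.norm_real]
    exact pow_le_one₀ (norm_nonneg _) hq1.le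
  have hwa2 : ∀ i, star (wa i) * wa i = 1 - (q : ℂ) ^ (2 * (i.1 + 1)) := fun i => by
    have : star (wa i) = wa i := Complex.conj_ofReal _
    rw [this, hwa_def]
    simp only
    rw [← Complex.ofReal_mul, Real.mul_self_sqrt (hq2 _)]
    push_cast
    rfl
  have hcc : ∀ m : ℤ, star (c⁻¹ ^ m) * c⁻¹ ^ m = 1 := fun m => by
    rw [star_zpow₀, star_inv₀, ← mul_zpow, ← mul_inv]
    rw [show star c * c = 1 by
      rw [show star c = c⁻¹ from (Complex.inv_eq_conj hc).symm, inv_mul_cancel₀ hc0]]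
    simp
  have hwg2 : ∀ i, star (wg i) * wg i = (q : ℂ) ^ (2 * i.1) := fun i => by
    rw [hwg_def]
    simp only
    rw [star_mul, star_pow, show star (q : ℂ) = q from Complex.conj_ofReal q]
    linear_combination ((q : ℂ) ^ (2 * i.1)) * hcc i.2
  set a := weightedComp wa (fun i : ℕ × ℤ => (i.1 + 1, i.2)) hwa
    (fun i j h => by simpa [Prod.ext_iff] using h)
  set g := weightedComp wg (fun i : ℕ × ℤ => i) hwg (fun i j h => h)
  set u := weightedComp (fun _ => 1) (fun i : ℕ × ℤ => (i.1, i.2 + 1)) (fun _ => by simp)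
    (fun i j h => by simpa [Prod.ext_iff] using h)
  have ha : ∀ f n m, a f (n, m) = wa (n, m) * f (n + 1, m) := fun f n m => rfl
  have hg : ∀ f n m, g f (n, m) = wg (n, m) * f (n, m) := fun f n m => rfl
  have hu : ∀ f n m, u f (n, m) = f (n, m + 1) := fun f n m => one_mul _
  have has : ∀ f n m, (star a) f (n + 1, m) = star (wa (n, m)) * f (n, m) := fun f n m =>
    star_weightedComp_apply f (n, m)
  have has0 : ∀ f m, (star a) f (0, m) = 0 := fun f m =>
    star_weightedComp_apply_of_notMem f (by simp)
  have hgs : ∀ f n m, (star g) f (n, m) = star (wg (n, m)) * f (n, m) := fun f n m =>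
    star_weightedComp_apply f (n, m)
  have hus : ∀ f n m, (star u) f (n, m) = f (n, m - 1) := fun f n m => by
    have := star_weightedComp_apply (w := fun _ => 1) (σ := fun i : ℕ × ℤ => (i.1, i.2 + 1))
      (hw := fun _ => by simp) (hσ := fun i j h => by simpa [Prod.ext_iff] using h) f (n, m - 1)
    simpa using this
  have hext : ∀ {T T' : SqSum (ℕ × ℤ) →L[ℂ] SqSum (ℕ × ℤ)},
      (∀ f n m, T f (n, m) = T' f (n, m)) → T = T' := fun h => by
    ext f ⟨n, m⟩
    exact h f n m
  refine ⟨a, g, u, ⟨?_, ?_, ?_, ?_, ?_, ?_, ?_, ?_, ?_⟩, ?_⟩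
  · refine hext fun f n m => ?_
    change (star g) (g f) (n, m) = g ((star g) f) (n, m)
    rw [hgs, hg, hg, hgs]
    ring
  · refine hext fun f n m => ?_
    change (q : ℂ) * (star g) (a f) (n, m) = a ((star g) f) (n, m)
    rw [hgs, ha, ha, hgs, hwg_def]
    simp only [star_mul, star_pow, show star (q : ℂ) = q from Complex.conj_ofReal q]
    ring
  · refine hext fun f n m => ?_
    change (q : ℂ) * g (a f) (n, m) = a (g f) (n, m)
    rw [hg, ha, ha, hg, hwg_def]
    simp only
    ring
  · refine hext fun f n m => ?_
    change (star a) (a f) (n, m) + (star g) (g f) (n, m) = f (n, m)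
    rw [hgs, hg]
    -- At n = 0 the term from a*a vanishes, and g*g alone contributes q⁰ = 1.
    cases n with
    | zero =>
      rw [has0]
      linear_combination f (0, m) * hwg2 (0, m)
    | succ n =>
      rw [has, ha]
      linear_combination f (n + 1, m) * (hwg2 (n + 1, m) + hwa2 (n, m))
  · refine hext fun f n m => ?_
    change a ((star a) f) (n, m) + (q : ℂ) ^ 2 * g ((star g) f) (n, m) = f (n, m)
    rw [ha, has, hg, hgs]
    linear_combination f (n, m) * ((q : ℂ) ^ 2 * hwg2 (n, m) + hwa2 (n, m))
  · refine hext fun f n m => ?_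
    change (star u) (u f) (n, m) = f (n, m)
    rw [hus, hu, sub_add_cancel]
  · refine hext fun f n m => ?_
    change u ((star u) f) (n, m) = f (n, m)
    rw [hu, hus, add_sub_cancel_right]
  · refine hext fun f n m => ?_
    change (star u) (g (u f)) (n, m) = c * g f (n, m)
    rw [hus, hg, hg, hu, sub_add_cancel, hwg_def]
    simp only
    rw [zpow_sub_one₀ (inv_ne_zero hc0), inv_inv]
    ring
  · refine hext fun f n m => ?_
    change (star u) (a (u f)) (n, m) = a f (n, m)
    rw [hus, ha, ha, hu, sub_add_cancel]
  · intro h0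
    have h1 := hg (lp.single 2 (0, 0) 1) 0 0
    rw [h0] at h1
    simp [hwg_def] at h1

end representation

/-! ### From faithful representations to the unique norm -/

theorem isPreCStarNorm_of_injective {A : Type} [Ring A] [Algebra ℂ A] [StarRing A] [StarModule ℂ A]
    {B : Type} [CStarAlgebra B] (φ : A →⋆ₐ[ℂ] B) (hφ : Function.Injective φ) :
    IsPreCStarNorm fun x => ‖φ x‖ := by
  -- The closure of the range is a C*-algebra in which the image is dense; it realises the
  -- completion.
  let S : StarSubalgebra ℂ B := φ.range.topologicalClosure
  have hS : IsClosed (S : Set B) := StarSubalgebra.isClosed_topologicalClosure _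
  have hmem : ∀ x, φ x ∈ S := fun x => StarSubalgebra.le_topologicalClosure _ ⟨x, rfl⟩
  refine ⟨S, inferInstance, φ.codRestrict S hmem, fun x y h => hφ (congrArg Subtype.val h), ?_,
    fun x => rfl⟩
  rw [DenseRange, Subtype.dense_iff]
  intro y hy
  have : (Subtype.val '' Set.range (φ.codRestrict S hmem) : Set B) = φ.range := by
    ext z
    constructor
    · rintro ⟨_, ⟨x, rfl⟩, rfl⟩; exact ⟨x, rfl⟩
    · rintro ⟨x, rfl⟩; exact ⟨_, ⟨x, rfl⟩, rfl⟩
  change y ∈ closure (Subtype.val '' Set.range (φ.codRestrict S hmem) : Set B)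
  rw [this]
  exact hy

end QuantumAlg

end

theorem theorem4p6 (q θ : ℝ) (hq_gt : -1 < q) (hq_lt : q < 1) (hq_ne : q ≠ 0)
    (hθ_pos : 0 < θ) (hθ_lt : θ < 1) (hθ : Irrational θ) :
    QuantumAlg.IsCStarUnique (QuantumAlg.Pol q θ) := by
  open QuantumAlg QuantumAlg.Pol in
  have hq1 : |q| < 1 := abs_lt.2 ⟨hq_gt, hq_lt⟩
  obtain ⟨a, g, u, H, hg⟩ := exists_isTriple hq1 (norm_phase θ)
  have hγ : lift H (gen q θ .γ) ≠ 0 := by rwa [lift_gen]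
  -- The concrete representation shows γ ≠ 0 in the algebra, so an injective representation cannot
  -- kill it; domination then holds in both directions.
  have hgen : gen q θ .γ ≠ 0 := fun h => hγ (by rw [h, map_zero])
  refine ⟨fun x => ‖lift H x‖,
    isPreCStarNorm_of_injective _ (injective_of_map_gen_ne_zero hq_ne hq1 hθ _ hγ), ?_⟩
  rintro p ⟨B, _, φ, hφ, -, hp⟩
  have hφγ : φ (gen q θ .γ) ≠ 0 := fun h => hgen (hφ (h.trans (map_zero φ).symm))
  funext x
  rw [hp x]
  exact le_antisymm (norm_le_norm hq_ne hq1 hθ _ _ hγ x) (norm_le_norm hq_ne hq1 hθ _ _ hφγ x)
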